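/- Setting. Let $\Gamma$ be a finite connected graph (loops and multiple edges allowed) with vertex set $\mathcal V$, edge set $\mathcal E$, $E=|\mathcal E|>1$, and no vertex of degree $2$ (a loop counts twice in the degree). Let $\partial\Gamma$ be the set of vertices of degree one and $\mathcal V_{in}=\mathcal V\setminus\partial\Gamma$. Every edge $e$ is identified with an interval $[0,l_e]$, $l_e>0$; let $L=\sum_e l_e$ and $L_{min}=\min_e l_e$. On any finite metric graph consider the Laplacian $f|_e\mapsto -f|_e''$ on the functions that are in $H^2$ on every edge and satisfy Neumann (Kirchhoff) vertex conditions: $f$ is continuous at every vertex, and at every vertex the outgoing derivatives of $f$ along the attached edge ends add up to $0$. An eigenfunction $f$ is called generic if its eigenvalue is simple, $f$ does not vanish at any vertex, and no outgoing derivative of $f$ at a vertex of $\mathcal V_{in}$ vanishes. For a generic eigenfunction $f$ with eigenvalue $k^2$, let $\phi(f)$ be the number of zeros of $f$, and $\mu(f)$ the number of zeros of $f'$ (the Neumann points), in the interiors of the edges. Cutting the graph at every Neumann point $x$, that is, replacing $x$ by two distinct vertices of degree one, gives a metric graph whose connected components are the Neumann domains of $f$. For $v\in\mathcal V_{in}$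 let $\Omega^{(v)}$ be the Neumann domain containing $v$, let $L_{\Omega^{(v)}}$ be its total length, let its spectral position $N(\Omega^{(v)})$ be the number of eigenvalues, counted with multiplicity, of the Laplacian of $\Omega^{(v)}$ (with Neumann vertex conditions) in $(0,k^2]$, and let its wavelength capacity be $\rho(\Omega^{(v)})=\frac{L_{\Omega^{(v)}}}{\pi}k$. Proposition. Let $f$ be a generic eigenfunction with eigenvalue $k^2$, where $k>\pi/L_{min}$. Then $\phi(f)$, $\mu(f)$ and all $N(\Omega^{(v)})$, $v\in\mathcal V_{in}$, are finite, and $$\sum_{v\in\mathcal V_{in}}N(\Omega^{(v)})=\phi(f)-\mu(f)+E-|\partial\Gamma|,\qquad \sum_{v\in\mathcal V_{in}}\rho(\Omega^{(v)})=\frac{L}{\pi}k-\mu(f)+E-|\partial\Gamma|.$$ -/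

import Mathlib

open MeasureTheory

/-- A metric graph with vertex type `V` and edge type `E`; loops and multiple edges are allowed.
The edge `e` is a copy of `[0, len e]`; the coordinate `0` is glued to the vertex `ends e false`
and the coordinate `len e` to the vertex `ends e true`. -/
structure MetricGraph (V E : Type*) where
  ends : E → Bool → V
  len : E → ℝ
  len_pos : ∀ e, 0 < len e

namespace MetricGraph

variable {V E : Type*}

/-! ### Combinatorial structure -/

/-- The simple graph recording which pairs of distinct vertices are joined by an edge. -/
def toSimpleGraph (G : MetricGraph V E) : SimpleGraph V :=
  SimpleGraph.fromRel (fun u w => ∃ e, G.ends e false = u ∧ G.ends e true = w)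

theorem reachable_ends (G : MetricGraph V E) (e : E) :
    G.toSimpleGraph.Reachable (G.ends e false) (G.ends e true) := by
  by_cases h : G.ends e false = G.ends e true
  · rw [h]
  · exact SimpleGraph.Adj.reachable
      ((SimpleGraph.fromRel_adj _ _ _).2 ⟨h, Or.inl ⟨e, rfl, rfl⟩⟩)

open Classical in
/-- The edge ends attached to `v`. A loop at `v` occurs twice. -/
noncomputable def edgesAt [Fintype E] (G : MetricGraph V E) (v : V) : Finset (E × Bool) :=
  Finset.univ.filter (fun d => G.ends d.1 d.2 = v)

noncomputable def deg [Fintype E] (G : MetricGraph V E) (v : V) : ℕ := (G.edgesAt v).card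

open Classical in
/-- The boundary `∂Γ`: the vertices of degree one. -/
noncomputable def boundary [Fintype V] [Fintype E] (G : MetricGraph V E) : Finset V :=
  Finset.univ.filter (fun v => G.deg v = 1)

open Classical in
/-- The interior vertices: all the vertices that are not boundary vertices. -/
noncomputable def interior [Fintype V] [Fintype E] (G : MetricGraph V E) : Finset V :=
  Finset.univ.filter (fun v => G.deg v ≠ 1)

/-- Underlying graph of a standard quantum graph: finite, connected, with more than one edge and
without vertices of degree two. -/
structure IsStandard [Fintype V] [Fintype E] (G : MetricGraph V E) : Prop where
  connected : G.toSimpleGraph.Connected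
  one_lt_card : 1 < Fintype.card E
  deg_ne_two : ∀ v, G.deg v ≠ 2

/-- The total length `L`. -/
noncomputable def totalLength [Fintype E] (G : MetricGraph V E) : ℝ := ∑ e, G.len e

/-- The minimal edge length `L_min`. -/
noncomputable def minLength (G : MetricGraph V E) : ℝ := ⨅ e, G.len e

/-! ### The Laplacian with Neumann vertex conditions

A function on the graph is a family `f : E → ℝ → ℂ`, where `f e` is the restriction to the edge
`e`; only its values on `[0, len e]` matter, and it is normalised to vanish elsewhere. -/

/-- `f` (restricted to `[0, l]`) is in the Sobolev space `H²([0, l])` with second derivative `h`: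
it is differentiable up to the end points, and `f'` is an antiderivative of `h ∈ L²([0, l])`. -/
structure HasH2Deriv (l : ℝ) (f h : ℝ → ℂ) : Prop where
  differentiable : DifferentiableOn ℝ f (Set.Icc 0 l)
  memLp : MemLp h 2 (volume.restrict (Set.Icc 0 l))
  integral_eq : ∀ x ∈ Set.Icc 0 l,
    derivWithin f (Set.Icc 0 l) x = derivWithin f (Set.Icc 0 l) 0 + ∫ t in (0 : ℝ)..x, h t

/-- The derivative of `f` along the edge `e`, in the coordinate of `e`, one-sided at the ends. -/
noncomputable def edgeDeriv (G : MetricGraph V E) (f : E → ℝ → ℂ) (e : E) (x : ℝ) : ℂ :=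
  derivWithin (f e) (Set.Icc 0 (G.len e)) x

/-- The value of `f` on an edge, at the given end of it. -/
noncomputable def endValue (G : MetricGraph V E) (f : E → ℝ → ℂ) : E × Bool → ℂ
  | (e, false) => f e 0
  | (e, true) => f e (G.len e)

/-- The outgoing derivative of `f` along an edge, at the given end of it. -/
noncomputable def outDeriv (G : MetricGraph V E) (f : E → ℝ → ℂ) : E × Bool → ℂ
  | (e, false) => G.edgeDeriv f e 0
  | (e, true) => - G.edgeDeriv f e (G.len e)

/-- Neumann (Kirchhoff) vertex conditions: continuity at every vertex, and the outgoing
derivatives at every vertex add up to zero. -/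
structure NeumannConditions [Fintype E] (G : MetricGraph V E) (f : E → ℝ → ℂ) : Prop where
  continuous : ∀ v, ∀ d ∈ G.edgesAt v, ∀ d' ∈ G.edgesAt v, G.endValue f d = G.endValue f d'
  sum_zero : ∀ v, ∑ d ∈ G.edgesAt v, G.outDeriv f d = 0

/-- `f` is an `H²` function in the domain of the Neumann Laplacian with `-f'' = lam f`. -/
structure SolvesEigen [Fintype E] (G : MetricGraph V E) (lam : ℝ) (f : E → ℝ → ℂ) : Prop where
  support : ∀ e, ∀ x ∉ Set.Icc 0 (G.len e), f e x = 0
  equation : ∀ e, ∃ h : ℝ → ℂ, HasH2Deriv (G.len e) (f e) h ∧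
    ∀ᵐ x ∂(volume.restrict (Set.Icc 0 (G.len e))), - h x = (lam : ℂ) * f e x
  neumann : G.NeumannConditions f

theorem HasH2Deriv.intervalIntegrable {l : ℝ} {f h : ℝ → ℂ} (H : HasH2Deriv l f h)
    {x : ℝ} (hx : x ∈ Set.Icc 0 l) : IntervalIntegrable h volume 0 x := by
  rw [intervalIntegrable_iff_integrableOn_Icc_of_le hx.1]
  have h1 : Integrable h (volume.restrict (Set.Icc 0 l)) := H.memLp.integrable (by norm_num)
  exact IntegrableOn.mono_set h1 (Set.Icc_subset_Icc_right hx.2)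

theorem HasH2Deriv.add {l : ℝ} (hl : 0 < l) {f g h j : ℝ → ℂ} (hf : HasH2Deriv l f h)
    (hg : HasH2Deriv l g j) : HasH2Deriv l (f + g) (h + j) := by
  refine ⟨hf.differentiable.add hg.differentiable, hf.memLp.add hg.memLp, fun x hx => ?_⟩
  have h0 : (0 : ℝ) ∈ Set.Icc 0 l := ⟨le_rfl, hl.le⟩
  rw [derivWithin_add (hf.differentiable x hx) (hg.differentiable x hx),
    derivWithin_add (hf.differentiable 0 h0) (hg.differentiable 0 h0),
    hf.integral_eq x hx, hg.integral_eq x hx]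
  have := intervalIntegral.integral_add (hf.intervalIntegrable hx) (hg.intervalIntegrable hx)
  simp only [Pi.add_apply]
  rw [this]
  ring

theorem HasH2Deriv.const_smul {l : ℝ} {f h : ℝ → ℂ} (c : ℂ) (hf : HasH2Deriv l f h) :
    HasH2Deriv l (c • f) (c • h) := by
  refine ⟨hf.differentiable.const_smul c, hf.memLp.const_smul c, fun x hx => ?_⟩
  rw [derivWithin_const_smul_field, derivWithin_const_smul_field, hf.integral_eq x hx]
  simp only [Pi.smul_apply, intervalIntegral.integral_smul, smul_add]

theorem SolvesEigen.edge_differentiable [Fintype E] {G : MetricGraph V E} {lam : ℝ}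
    {f : E → ℝ → ℂ} (hf : G.SolvesEigen lam f) (e : E) :
    DifferentiableOn ℝ (f e) (Set.Icc 0 (G.len e)) := by
  obtain ⟨h, H, -⟩ := hf.equation e
  exact H.differentiable

theorem SolvesEigen.outDeriv_add [Fintype E] {G : MetricGraph V E} {lam : ℝ}
    {f g : E → ℝ → ℂ} (hf : G.SolvesEigen lam f) (hg : G.SolvesEigen lam g) (d : E × Bool) :
    G.outDeriv (f + g) d = G.outDeriv f d + G.outDeriv g d := by
  obtain ⟨e, b⟩ := d
  have h0 : (0 : ℝ) ∈ Set.Icc 0 (G.len e) := ⟨le_rfl, (G.len_pos e).le⟩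
  have h1 : G.len e ∈ Set.Icc 0 (G.len e) := ⟨(G.len_pos e).le, le_rfl⟩
  cases b
  · exact derivWithin_add (hf.edge_differentiable e _ h0) (hg.edge_differentiable e _ h0)
  · have := derivWithin_add (hf.edge_differentiable e _ h1) (hg.edge_differentiable e _ h1)
    simp only [outDeriv, edgeDeriv, Pi.add_apply, this]
    ring

theorem endValue_add (G : MetricGraph V E) (f g : E → ℝ → ℂ) (d : E × Bool) :
    G.endValue (f + g) d = G.endValue f d + G.endValue g d := by
  obtain ⟨e, b⟩ := d
  cases b <;> rfl

theorem endValue_smul (G : MetricGraph V E) (c : ℂ) (f : E → ℝ → ℂ) (d : E × Bool) :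
    G.endValue (c • f) d = c * G.endValue f d := by
  obtain ⟨e, b⟩ := d
  cases b <;> rfl

theorem outDeriv_smul (G : MetricGraph V E) (c : ℂ) (f : E → ℝ → ℂ) (d : E × Bool) :
    G.outDeriv (c • f) d = c * G.outDeriv f d := by
  obtain ⟨e, b⟩ := d
  cases b
  · exact derivWithin_const_smul_field c (f e)
  · have : derivWithin (c • f e) (Set.Icc 0 (G.len e)) (G.len e)
        = c • derivWithin (f e) (Set.Icc 0 (G.len e)) (G.len e) :=
      derivWithin_const_smul_field c (f e)
    simp only [outDeriv, edgeDeriv, Pi.smul_apply, this, smul_eq_mul, mul_neg]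

theorem SolvesEigen.add [Fintype E] {G : MetricGraph V E} {lam : ℝ} {f g : E → ℝ → ℂ}
    (hf : G.SolvesEigen lam f) (hg : G.SolvesEigen lam g) : G.SolvesEigen lam (f + g) := by
  refine ⟨fun e x hx => ?_, fun e => ?_, ⟨fun v d hd d' hd' => ?_, fun v => ?_⟩⟩
  · simp [hf.support e x hx, hg.support e x hx]
  · obtain ⟨h, H, hh⟩ := hf.equation e
    obtain ⟨j, J, hj⟩ := hg.equation e
    refine ⟨h + j, H.add (G.len_pos e) J, ?_⟩
    filter_upwards [hh, hj] with x h1 h2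
    simp only [Pi.add_apply, mul_add, ← h1, ← h2]
    ring
  · rw [endValue_add, endValue_add, hf.neumann.continuous v d hd d' hd',
      hg.neumann.continuous v d hd d' hd']
  · simp only [hf.outDeriv_add hg, Finset.sum_add_distrib, hf.neumann.sum_zero v,
      hg.neumann.sum_zero v, add_zero]

theorem SolvesEigen.smul [Fintype E] {G : MetricGraph V E} {lam : ℝ} {f : E → ℝ → ℂ} (c : ℂ)
    (hf : G.SolvesEigen lam f) : G.SolvesEigen lam (c • f) := by
  refine ⟨fun e x hx => ?_, fun e => ?_, ⟨fun v d hd d' hd' => ?_, fun v => ?_⟩⟩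
  · simp [hf.support e x hx]
  · obtain ⟨h, H, hh⟩ := hf.equation e
    refine ⟨c • h, H.const_smul c, ?_⟩
    filter_upwards [hh] with x h1
    simp only [Pi.smul_apply, smul_eq_mul]
    linear_combination c * h1
  · rw [endValue_smul, endValue_smul, hf.neumann.continuous v d hd d' hd']
  · simp only [outDeriv_smul, ← Finset.mul_sum, hf.neumann.sum_zero v, mul_zero]

theorem solvesEigen_zero [Fintype E] (G : MetricGraph V E) (lam : ℝ) : G.SolvesEigen lam 0 := by
  have hd : ∀ d, G.outDeriv 0 d = 0 := by
    intro d
    have := G.outDeriv_smul 0 0 d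
    simpa using this
  have hv : ∀ d, G.endValue 0 d = 0 := by
    intro d
    have := G.endValue_smul 0 0 d
    simpa using this
  refine ⟨fun e x hx => rfl, fun e => ⟨0, ⟨differentiableOn_const (0 : ℂ), MemLp.zero, ?_⟩, ?_⟩,
    ⟨fun v d _ d' _ => by rw [hv, hv], fun v => by simp [hd]⟩⟩
  · intro x hx
    simp
  · exact Filter.Eventually.of_forall (fun x => by simp)

/-- The eigenspace of the Neumann Laplacian for the (real) number `lam`. -/
def eigenspace [Fintype E] (G : MetricGraph V E) (lam : ℝ) : Submodule ℂ (E → ℝ → ℂ) where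
  carrier := {f | G.SolvesEigen lam f}
  add_mem' hf hg := hf.add hg
  zero_mem' := G.solvesEigen_zero lam
  smul_mem' c _ hf := hf.smul c

/-- `lam` is an eigenvalue of the graph. -/
def IsEigenvalue [Fintype E] (G : MetricGraph V E) (lam : ℝ) : Prop := G.eigenspace lam ≠ ⊥

/-- The spectral counting function `N(Γ, k)`: the number of eigenvalues in `(0, k²]`, counted
with multiplicity. -/
noncomputable def spectralCount [Fintype E] (G : MetricGraph V E) (k : ℝ) : ℕ :=
  ∑ᶠ lam ∈ Set.Ioc 0 (k ^ 2), Module.finrank ℂ (G.eigenspace lam)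

/-- The count `spectralCount` counts finitely many eigenvalues, of finite multiplicity. -/
def SpectralCountFinite [Fintype E] (G : MetricGraph V E) (k : ℝ) : Prop :=
  {lam ∈ Set.Ioc 0 (k ^ 2) | G.IsEigenvalue lam}.Finite ∧
    ∀ lam ∈ Set.Ioc 0 (k ^ 2), FiniteDimensional ℂ (G.eigenspace lam)

/-- The wavelength capacity `L k / π` of a metric graph at `k`. -/
noncomputable def wavelengthCapacity [Fintype E] (G : MetricGraph V E) (k : ℝ) : ℝ :=
  G.totalLength / Real.pi * k

/-- `f` is a generic eigenfunction with eigenvalue `lam`: the eigenvalue is simple, `f` does not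
vanish at vertices, and no outgoing derivative of `f` at an interior vertex vanishes. -/
structure IsGeneric [Fintype V] [Fintype E] (G : MetricGraph V E) (lam : ℝ) (f : E → ℝ → ℂ) :
    Prop where
  mem : f ∈ G.eigenspace lam
  ne_zero : f ≠ 0
  simple : Module.finrank ℂ (G.eigenspace lam) = 1
  value_ne_zero : ∀ v, ∀ d ∈ G.edgesAt v, G.endValue f d ≠ 0
  deriv_ne_zero : ∀ v ∈ G.interior, ∀ d ∈ G.edgesAt v, G.outDeriv f d ≠ 0

/-! ### Nodal and Neumann points -/

/-- The nodal points: the zeros of `f` in the interiors of the edges. -/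
def nodalSet (G : MetricGraph V E) (f : E → ℝ → ℂ) : Set (E × ℝ) :=
  {p | p.2 ∈ Set.Ioo 0 (G.len p.1) ∧ f p.1 p.2 = 0}

/-- The Neumann points: the zeros of `f'` in the interiors of the edges. -/
def neumannSet (G : MetricGraph V E) (f : E → ℝ → ℂ) : Set (E × ℝ) :=
  {p | p.2 ∈ Set.Ioo 0 (G.len p.1) ∧ G.edgeDeriv f p.1 p.2 = 0}

noncomputable def nodalCount (G : MetricGraph V E) (f : E → ℝ → ℂ) : ℕ := (G.nodalSet f).ncard

noncomputable def neumannCount (G : MetricGraph V E) (f : E → ℝ → ℂ) : ℕ := (G.neumannSet f).ncard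

/-! ### Cutting a graph at interior points, connected components -/

open Classical in
/-- The positions on `e` of the points of `P` which lie after the position `a`. -/
noncomputable def laterCuts (P : Finset (E × ℝ)) (e : E) (a : ℝ) : Finset ℝ :=
  (P.filter (fun q => q.1 = e ∧ a < q.2)).image Prod.snd

theorem mem_laterCuts {P : Finset (E × ℝ)} {e : E} {a x : ℝ} :
    x ∈ laterCuts P e a ↔ (e, x) ∈ P ∧ a < x := by
  classical
  simp only [laterCuts, Finset.mem_image, Finset.mem_filter]
  constructor
  · rintro ⟨⟨e', y⟩, ⟨hP, rfl, hlt⟩, rfl⟩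
    exact ⟨hP, hlt⟩
  · rintro ⟨hP, hlt⟩
    exact ⟨(e, x), ⟨hP, rfl, hlt⟩, rfl⟩

open Classical in
/-- The position where the piece of `e` that starts at the position `a` ends: the next point of
`P` on `e`, or the end of `e`. -/
noncomputable def pieceEnd (G : MetricGraph V E) (P : Finset (E × ℝ)) (e : E) (a : ℝ) : ℝ :=
  if h : (laterCuts P e a).Nonempty then (laterCuts P e a).min' h else G.len e

open Classical in
/-- The vertex of the cut graph where the piece of `e` that starts at the position `a` ends. -/
noncomputable def pieceEndVertex (G : MetricGraph V E) (P : Finset (E × ℝ)) (e : E) (a : ℝ) :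
    V ⊕ (P × Bool) :=
  if h : (laterCuts P e a).Nonempty then
    Sum.inr (⟨(e, (laterCuts P e a).min' h),
      (mem_laterCuts.1 ((laterCuts P e a).min'_mem h)).1⟩, false)
  else Sum.inl (G.ends e true)

/-- The graph cut at a finite set `P` of interior points of edges. Each `p ∈ P` is replaced by two
vertices of degree one: `(p, false)` ends the piece before `p`, and `(p, true)` starts the piece
after `p`. The piece `Sum.inl e` is the one at the start of the edge `e`, and the piece `Sum.inr p`
is the one that starts at `p`. -/
noncomputable def cut (G : MetricGraph V E) (P : Finset (E × ℝ))
    (hP : ∀ p ∈ P, p.2 ∈ Set.Ioo 0 (G.len p.1)) : MetricGraph (V ⊕ (P × Bool)) (E ⊕ P) where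
  ends
    | Sum.inl e, false => Sum.inl (G.ends e false)
    | Sum.inr p, false => Sum.inr (p, true)
    | Sum.inl e, true => G.pieceEndVertex P e 0
    | Sum.inr p, true => G.pieceEndVertex P p.1.1 p.1.2
  len
    | Sum.inl e => G.pieceEnd P e 0
    | Sum.inr p => G.pieceEnd P p.1.1 p.1.2 - p.1.2
  len_pos := by
    have key : ∀ (e : E) (a : ℝ), a < G.len e → a < G.pieceEnd P e a := by
      intro e a ha
      unfold pieceEnd
      split_ifs with h
      · exact (mem_laterCuts.1 ((laterCuts P e a).min'_mem h)).2
      · exact ha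
    rintro (e | p)
    · exact key e 0 (G.len_pos e)
    · exact sub_pos.2 (key p.1.1 p.1.2 (hP p.1 p.2).2)

/-- The connected component of the vertex `v`, as a metric graph. -/
def component (G : MetricGraph V E) (v : V) :
    MetricGraph {w // G.toSimpleGraph.Reachable v w}
      {e // G.toSimpleGraph.Reachable v (G.ends e false)} where
  ends e b := ⟨G.ends e.1 b, by
    cases b
    · exact e.2
    · exact e.2.trans (G.reachable_ends e.1)⟩
  len e := G.len e.1
  len_pos e := G.len_pos e.1

open Classical in
/-- The set of Neumann points as a `Finset`. (It is empty if there are infinitely many Neumann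
points, which does not happen for a generic eigenfunction of positive eigenvalue.) -/
noncomputable def neumannPoints (G : MetricGraph V E) (f : E → ℝ → ℂ) : Finset (E × ℝ) :=
  if h : (G.neumannSet f).Finite then h.toFinset else ∅

theorem neumannPoints_mem (G : MetricGraph V E) (f : E → ℝ → ℂ) :
    ∀ p ∈ G.neumannPoints f, p.2 ∈ Set.Ioo 0 (G.len p.1) := by
  intro p hp
  unfold neumannPoints at hp
  split_ifs at hp with h
  · exact ((Set.Finite.mem_toFinset h).1 hp).1
  · simp at hp

/-- The Neumann partition of the graph: the graph cut at the Neumann points of `f`. -/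
noncomputable def neumannPartition (G : MetricGraph V E) (f : E → ℝ → ℂ) :
    MetricGraph (V ⊕ (G.neumannPoints f × Bool)) (E ⊕ G.neumannPoints f) :=
  G.cut (G.neumannPoints f) (G.neumannPoints_mem f)

/-- The vertices of the Neumann domain containing `v`. -/
abbrev NeumannDomainV (G : MetricGraph V E) (f : E → ℝ → ℂ) (v : V) : Type _ :=
  {w // (G.neumannPartition f).toSimpleGraph.Reachable (Sum.inl v) w}

/-- The edges of the Neumann domain containing `v`. -/
abbrev NeumannDomainE (G : MetricGraph V E) (f : E → ℝ → ℂ) (v : V) : Type _ :=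
  {e // (G.neumannPartition f).toSimpleGraph.Reachable (Sum.inl v)
    ((G.neumannPartition f).ends e false)}

open Classical in
noncomputable instance [Fintype E] (G : MetricGraph V E) (f : E → ℝ → ℂ) (v : V) :
    Fintype (G.NeumannDomainE f v) := Subtype.fintype _

/-- The Neumann domain `Ω⁽ᵛ⁾` of `f` containing the vertex `v`, as a metric graph. -/
noncomputable def neumannDomain (G : MetricGraph V E) (f : E → ℝ → ℂ) (v : V) :
    MetricGraph (G.NeumannDomainV f v) (G.NeumannDomainE f v) :=
  (G.neumannPartition f).component (Sum.inl v)

end MetricGraph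

/-!
Why the two formulas hold. Since the eigenvalue is simple, `f` is a complex multiple of a real
function, so on every edge it is a shifted cosine of wave number `k`
(`MetricGraph.IsGeneric.exists_eq_cos`), and its Neumann points on the edge are `π / k` apart. Every
edge is longer than `π / k`, hence contains a Neumann point. For an edge end `d` let `s d ∈ (0, π]`
be `k` times the distance from that end to the nearest Neumann point on the edge. An edge with
`n + 1` Neumann points then satisfies `k * len = s + n π + s'`, and it contains `n` zeros of `f`, plus
one for each of its ends with `s d > π / 2` (`MetricGraph.WaveData`). At a boundary vertex the
derivative of `f` vanishes, so `s d = π` there.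

The Neumann domain of an interior vertex `v` is a star graph with centre `v`, whose edges correspond
to the edge ends at `v` and have the lengths `s d / k` (`MetricGraph.CutEnds.component_isStar`,
`MetricGraph.WaveData.exists_equiv_edgesAt`). Adding up `s d / π` over all edge ends gives the formula
for the wavelength capacities; the ends at the boundary contribute `|∂Γ|`.

The spectral position of such a star is the number of its edges with `s d > π / 2`
(`MetricGraph.IsStar.spectralCount_eq`), and adding up over all edge ends again gives the first
formula. To compute it, consider the secular function `F κ = ∑ tan (κ lᵢ)` of the star with edge
lengths `lᵢ < π / k`. If no `κ lᵢ` is `π / 2`, then `κ²` is an eigenvalue only if `F κ = 0`, and it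
is then simple; at a pole, where `m` of the numbers `κ lᵢ` are `π / 2`, the multiplicity of `κ²` is
`m - 1`. The function `F` is positive before the first pole and increases from `-∞` to `∞` between
consecutive poles, and the vertex condition for `f` at `v` says that `F k = 0`. So each pole in
`(0, k)` is followed by exactly one zero in `(0, k]` before the next pole
(`TanSum.zeros_finite_and_ncard`), a pole and its zero together account for `m` eigenvalues, and
every edge with `k lᵢ > π / 2` belongs to exactly one pole.
-/

/-! ### Solutions of the eigenvalue equation on an edge -/

theorem hasDerivAt_trigCombination (κ : ℝ) (a b : ℂ) (x : ℝ) :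
    HasDerivAt (fun y : ℝ => a * (Real.cos (κ * y) : ℂ) + b * (Real.sin (κ * y) : ℂ))
      (κ * (b * (Real.cos (κ * x) : ℂ) - a * (Real.sin (κ * x) : ℂ))) x := by
  have hid : HasDerivAt (fun y : ℝ => κ * y) κ x := by
    simpa using (hasDerivAt_id x).const_mul κ
  have h1 := (((Real.hasDerivAt_cos (κ * x)).comp x hid).ofReal_comp).const_mul a
  have h2 := (((Real.hasDerivAt_sin (κ * x)).comp x hid).ofReal_comp).const_mul b
  refine (h1.add h2).congr_deriv ?_
  push_cast
  ring

theorem derivWithin_eq_of_eqOn_trig {l κ : ℝ} (hl : 0 < l) {f : ℝ → ℂ} {a b : ℂ}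
    (hf : ∀ x ∈ Set.Icc 0 l, f x = a * (Real.cos (κ * x) : ℂ) + b * (Real.sin (κ * x) : ℂ))
    {x : ℝ} (hx : x ∈ Set.Icc 0 l) :
    HasDerivWithinAt f (κ * (b * (Real.cos (κ * x) : ℂ) - a * (Real.sin (κ * x) : ℂ)))
      (Set.Icc 0 l) x ∧
    derivWithin f (Set.Icc 0 l) x
      = κ * (b * (Real.cos (κ * x) : ℂ) - a * (Real.sin (κ * x) : ℂ)) := by
  have h := ((hasDerivAt_trigCombination κ a b x).hasDerivWithinAt (s := Set.Icc 0 l)).congr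
    hf (hf x hx)
  exact ⟨h, h.derivWithin (uniqueDiffOn_Icc hl x hx)⟩

/-- An `H²` solution of `-f'' = κ² f` satisfies the equation classically: almost everywhere
`f''` agrees with the continuous function `-κ² f`, so `f'` is continuously differentiable. -/
theorem MetricGraph.HasH2Deriv.hasDerivWithinAt_derivWithin {l κ : ℝ} {f h : ℝ → ℂ}
    (hl : 0 < l) (H : MetricGraph.HasH2Deriv l f h)
    (hh : ∀ᵐ x ∂(volume.restrict (Set.Icc 0 l)), - h x = ((κ ^ 2 : ℝ) : ℂ) * f x)
    {x : ℝ} (hx : x ∈ Set.Icc 0 l) :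
    HasDerivWithinAt (derivWithin f (Set.Icc 0 l)) (-(κ : ℂ) ^ 2 * f x) (Set.Icc 0 l) x := by
  -- The continuous extension of `-κ² f` to the line makes the two-sided fundamental theorem of
  -- calculus available at the ends of the interval.
  set F : ℝ → ℂ := fun y => -(κ : ℂ) ^ 2 * Set.IccExtend hl.le (Set.domRestrict (Set.Icc 0 l) f) y
    with hF
  have hFc : Continuous F := by
    refine continuous_const.mul (Continuous.Icc_extend' ?_)
    exact continuousOn_iff_continuous_domRestrict.1 H.differentiable.continuousOn
  have hFf : ∀ y ∈ Set.Icc 0 l, F y = -(κ : ℂ) ^ 2 * f y := by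
    intro y hy
    simp only [hF, Set.IccExtend_of_mem hl.le _ hy, Set.domRestrict_apply]
  have key : ∀ y ∈ Set.Icc 0 l, derivWithin f (Set.Icc 0 l) y
      = derivWithin f (Set.Icc 0 l) 0 + ∫ t in (0 : ℝ)..y, F t := by
    intro y hy
    rw [H.integral_eq y hy]
    congr 1
    apply intervalIntegral.integral_congr_ae
    rw [Set.uIoc_of_le hy.1]
    have h1 := (ae_restrict_iff' measurableSet_Icc).1 hh
    filter_upwards [h1] with t ht htI
    have htI' : t ∈ Set.Icc 0 l := ⟨htI.1.le, htI.2.trans hy.2⟩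
    have := ht htI'
    rw [hFf t htI']
    push_cast at this
    linear_combination -this
  have hd : HasDerivAt (fun y => derivWithin f (Set.Icc 0 l) 0 + ∫ t in (0 : ℝ)..y, F t)
      (F x) x := (hFc.integral_hasStrictDerivAt 0 x).hasDerivAt.const_add _
  have := hd.hasDerivWithinAt (s := Set.Icc 0 l) |>.congr key (key x hx)
  rwa [hFf x hx] at this

/-- The two quantities `f cos - f' sin / κ` and `f sin + f' cos / κ` are constant for a solution
`f`; they are its coefficients. -/
theorem MetricGraph.HasH2Deriv.exists_trig {l κ : ℝ} {f h : ℝ → ℂ} (hl : 0 < l) (hκ : 0 < κ)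
    (H : MetricGraph.HasH2Deriv l f h)
    (hh : ∀ᵐ x ∂(volume.restrict (Set.Icc 0 l)), - h x = ((κ ^ 2 : ℝ) : ℂ) * f x) :
    ∃ a b : ℂ, ∀ x ∈ Set.Icc 0 l,
      f x = a * (Real.cos (κ * x) : ℂ) + b * (Real.sin (κ * x) : ℂ) := by
  set g := derivWithin f (Set.Icc 0 l) with hg
  have hκ' : (κ : ℂ) ≠ 0 := by exact_mod_cast hκ.ne'
  have hc : ∀ x, HasDerivAt (fun y : ℝ => (Real.cos (κ * y) : ℂ))
      (-κ * (Real.sin (κ * x) : ℂ)) x := fun x => by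
    simpa using hasDerivAt_trigCombination κ 1 0 x
  have hs : ∀ x, HasDerivAt (fun y : ℝ => (Real.sin (κ * y) : ℂ))
      (κ * (Real.cos (κ * x) : ℂ)) x := fun x => by
    simpa using hasDerivAt_trigCombination κ 0 1 x
  have const : ∀ W : ℝ → ℂ, (∀ x ∈ Set.Icc 0 l, HasDerivWithinAt W 0 (Set.Icc 0 l) x) →
      ∀ x ∈ Set.Icc 0 l, W x = W 0 := fun W hW =>
    constant_of_derivWithin_zero (fun x hx => (hW x hx).differentiableWithinAt)
      (fun x hx => (hW x ⟨hx.1, hx.2.le⟩).derivWithin (uniqueDiffOn_Icc hl x ⟨hx.1, hx.2.le⟩))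
  have hW1 := const (fun y => f y * (Real.cos (κ * y) : ℂ) - g y * (Real.sin (κ * y) : ℂ) / κ) (by
    intro x hx
    have hf := (H.differentiable x hx).hasDerivWithinAt
    have hg' := H.hasDerivWithinAt_derivWithin hl hh hx
    refine ((hf.mul (hc x).hasDerivWithinAt).sub
      ((hg'.mul (hs x).hasDerivWithinAt).div_const (κ : ℂ))).congr_deriv ?_
    field_simp
    ring)
  have hW2 := const (fun y => f y * (Real.sin (κ * y) : ℂ) + g y * (Real.cos (κ * y) : ℂ) / κ) (by
    intro x hx
    have hf := (H.differentiable x hx).hasDerivWithinAt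
    have hg' := H.hasDerivWithinAt_derivWithin hl hh hx
    refine ((hf.mul (hs x).hasDerivWithinAt).add
      ((hg'.mul (hc x).hasDerivWithinAt).div_const (κ : ℂ))).congr_deriv ?_
    field_simp
    ring)
  refine ⟨f 0, g 0 / κ, fun x hx => ?_⟩
  have h1 := hW1 x hx
  have h2 := hW2 x hx
  simp only [mul_zero, Real.cos_zero, Real.sin_zero, Complex.ofReal_one, Complex.ofReal_zero,
    mul_one, zero_div, sub_zero, zero_add] at h1 h2
  rw [← h1, ← h2]
  have h3 : ((Real.sin (κ * x) : ℂ)) ^ 2 + (Real.cos (κ * x) : ℂ) ^ 2 = 1 := by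
    exact_mod_cast Real.sin_sq_add_cos_sq (κ * x)
  linear_combination -(f x) * h3

theorem MetricGraph.hasH2Deriv_of_eqOn_trig {l κ : ℝ} (hl : 0 < l) {f : ℝ → ℂ} {a b : ℂ}
    (hf : ∀ x ∈ Set.Icc 0 l, f x = a * (Real.cos (κ * x) : ℂ) + b * (Real.sin (κ * x) : ℂ)) :
    ∃ h : ℝ → ℂ, MetricGraph.HasH2Deriv l f h ∧
      ∀ᵐ x ∂(volume.restrict (Set.Icc 0 l)), - h x = ((κ ^ 2 : ℝ) : ℂ) * f x := by
  have hcont : Continuous (fun x : ℝ => -(κ : ℂ) ^ 2 * (a * (Real.cos (κ * x) : ℂ)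
      + b * (Real.sin (κ * x) : ℂ))) := by fun_prop
  refine ⟨fun x => -(κ : ℂ) ^ 2 * (a * (Real.cos (κ * x) : ℂ) + b * (Real.sin (κ * x) : ℂ)),
    ⟨fun x hx => (derivWithin_eq_of_eqOn_trig hl hf hx).1.differentiableWithinAt, ?_, ?_⟩, ?_⟩
  · obtain ⟨C, hC⟩ := isCompact_Icc.exists_bound_of_continuousOn (s := Set.Icc 0 l)
      hcont.continuousOn
    refine MemLp.of_bound hcont.aestronglyMeasurable C ?_
    exact (ae_restrict_iff' measurableSet_Icc).2 (Filter.Eventually.of_forall hC)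
  · intro x hx
    rw [(derivWithin_eq_of_eqOn_trig hl hf hx).2,
      (derivWithin_eq_of_eqOn_trig hl hf ⟨le_rfl, hl.le⟩).2]
    have hd : ∀ y ∈ Set.uIcc 0 x, HasDerivAt
        (fun y : ℝ => κ * (b * (Real.cos (κ * y) : ℂ) - a * (Real.sin (κ * y) : ℂ)))
        (-(κ : ℂ) ^ 2 * (a * (Real.cos (κ * y) : ℂ) + b * (Real.sin (κ * y) : ℂ))) y := by
      intro y _
      have := (hasDerivAt_trigCombination κ b (-a) y).const_mul (κ : ℂ)
      refine (this.congr_deriv (by ring)).congr_of_eventuallyEq ?_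
      exact Filter.Eventually.of_forall fun z => by ring
    rw [intervalIntegral.integral_eq_sub_of_hasDerivAt hd (hcont.intervalIntegrable _ _)]
    ring
  · refine (ae_restrict_iff' measurableSet_Icc).2 (Filter.Eventually.of_forall fun x hx => ?_)
    rw [hf x hx]
    push_cast
    ring

namespace MetricGraph

variable {V E : Type*}

theorem solvesEigen_sq_iff [Fintype E] (G : MetricGraph V E) {κ : ℝ} (hκ : 0 < κ)
    (f : E → ℝ → ℂ) :
    G.SolvesEigen (κ ^ 2) f ↔ (∀ e, ∀ x ∉ Set.Icc 0 (G.len e), f e x = 0) ∧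
      (∀ e, ∃ a b : ℂ, ∀ x ∈ Set.Icc 0 (G.len e),
        f e x = a * (Real.cos (κ * x) : ℂ) + b * (Real.sin (κ * x) : ℂ)) ∧
      G.NeumannConditions f := by
  constructor
  · intro h
    refine ⟨h.support, fun e => ?_, h.neumann⟩
    obtain ⟨j, H, hj⟩ := h.equation e
    exact H.exists_trig (G.len_pos e) hκ hj
  · rintro ⟨h1, h2, h3⟩
    refine ⟨h1, fun e => ?_, h3⟩
    obtain ⟨a, b, hab⟩ := h2 e
    exact hasH2Deriv_of_eqOn_trig (G.len_pos e) hab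

end MetricGraph

/-! ### Zeros of a sum of tangents -/

theorem Filter.tendsto_sum_atTop_of_exists {α ι : Type*} {L : Filter α} (s : Finset ι)
    (u : ι → α → ℝ)
    (h : ∀ i ∈ s, Filter.Tendsto (u i) L Filter.atTop ∨ ∃ c, Filter.Tendsto (u i) L (nhds c))
    {i₀ : ι} (hi₀ : i₀ ∈ s) (h₀ : Filter.Tendsto (u i₀) L Filter.atTop) :
    Filter.Tendsto (fun x => ∑ i ∈ s, u i x) L Filter.atTop := by
  classical
  have hb : ∀ i ∈ s, ∃ m, ∀ᶠ x in L, m ≤ u i x := by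
    intro i hi
    rcases h i hi with h | ⟨c, hc⟩
    · exact ⟨0, h.eventually_ge_atTop 0⟩
    · exact ⟨c - 1, (hc.eventually_const_lt (sub_one_lt c)).mono fun x hx => hx.le⟩
  choose! m hm using hb
  have hrest : ∀ᶠ x in L, ∑ i ∈ s.erase i₀, m i ≤ ∑ i ∈ s.erase i₀, u i x := by
    have := (Finset.eventually_all (s.erase i₀)).2
      (fun i hi => hm i (Finset.mem_of_mem_erase hi))
    exact this.mono fun x hx => Finset.sum_le_sum hx
  have := Filter.tendsto_atTop_add_right_of_le' L _ h₀ hrest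
  refine this.congr fun x => ?_
  exact Finset.add_sum_erase s (fun i => u i x) hi₀

namespace TanSum

theorem cos_ne_zero_of_mem_Ioo {x : ℝ} (h0 : 0 < x) (h1 : x < Real.pi) (h : x ≠ Real.pi / 2) :
    Real.cos x ≠ 0 := by
  rcases lt_or_gt_of_ne h with h | h
  · exact (Real.cos_pos_of_mem_Ioo ⟨by linarith, h⟩).ne'
  · exact (Real.cos_neg_of_pi_div_two_lt_of_lt h (by linarith)).ne

theorem continuousAt_tan_mul {ι : Type*} {l : ι → ℝ} {K : ℝ} (hl : ∀ i, 0 < l i) (hK : ∀ i, K * l i < Real.pi) {p : ℝ}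
    (h0 : 0 < p) (hpK : p ≤ K) {i : ι} (hi : p * l i ≠ Real.pi / 2) :
    ContinuousAt (fun κ => Real.tan (κ * l i)) p := by
  have hc := cos_ne_zero_of_mem_Ioo (mul_pos h0 (hl i))
    ((mul_le_mul_of_nonneg_right hpK (hl i).le).trans_lt (hK i)) hi
  exact ContinuousAt.comp (f := fun κ => κ * l i) (Real.continuousAt_tan.2 hc) (by fun_prop)
variable {ι : Type*} [Fintype ι] (l : ι → ℝ)

/-- The secular function of the star graph with edge lengths `l`. -/
noncomputable def tanSum (κ : ℝ) : ℝ := ∑ i, Real.tan (κ * l i)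

open Classical in
/-- The edges at which the secular function has a pole at `κ`, if all `κ * l i` are in `(0, π)`. -/
noncomputable def poleIndices (κ : ℝ) : Finset ι :=
  Finset.univ.filter (fun i => κ * l i = Real.pi / 2)

open Classical in
/-- The poles of the secular function in `(0, K)`, if all `K * l i` are in `(0, π)`. -/
noncomputable def poles (K : ℝ) : Finset ℝ :=
  (Finset.univ.filter (fun i => Real.pi / 2 < K * l i)).image (fun i => Real.pi / 2 / l i)

/-- The zeros of the secular function in `(0, K]`; the poles are excluded, because there the
tangent takes the junk value `0`. -/
def zeros (K : ℝ) : Set ℝ := {κ ∈ Set.Ioc 0 K | poleIndices l κ = ∅ ∧ tanSum l κ = 0}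

variable {l}

theorem mem_poles (hl : ∀ i, 0 < l i) {K p : ℝ} :
    p ∈ poles l K ↔ p < K ∧ (poleIndices l p).Nonempty := by
  classical
  simp only [poles, poleIndices, Finset.mem_image, Finset.mem_filter, Finset.mem_univ, true_and,
    Finset.Nonempty]
  constructor
  · rintro ⟨i, hi, rfl⟩
    exact ⟨(div_lt_iff₀ (hl i)).2 hi, i, div_mul_cancel₀ _ (hl i).ne'⟩
  · rintro ⟨hp, i, hi⟩
    refine ⟨i, hi ▸ mul_lt_mul_of_pos_right hp (hl i), ?_⟩
    rw [← hi, mul_div_cancel_right₀ _ (hl i).ne']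

theorem pos_of_mem_poles (hl : ∀ i, 0 < l i) {K p : ℝ} (hp : p ∈ poles l K) : 0 < p := by
  classical
  obtain ⟨i, -, rfl⟩ := Finset.mem_image.1 hp
  exact div_pos Real.pi_div_two_pos (hl i)

theorem ne_pi_div_two_of_poleIndices_eq_empty {κ : ℝ} (h : poleIndices l κ = ∅) (i : ι) :
    κ * l i ≠ Real.pi / 2 := by
  intro hi
  have : i ∈ poleIndices l κ := by simp [poleIndices, hi]
  simp [h] at this

theorem card_pi_div_two_lt_eq_sum (hl : ∀ i, 0 < l i) (K : ℝ) :
    (Finset.univ.filter (fun i => Real.pi / 2 < K * l i)).card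
      = ∑ p ∈ poles l K, (poleIndices l p).card := by
  classical
  rw [Finset.card_eq_sum_card_image (fun i => Real.pi / 2 / l i)]
  refine Finset.sum_congr (by unfold poles; congr) fun p hp => ?_
  congr 1
  have hpK := ((mem_poles hl).1 hp).1
  ext i
  simp only [poleIndices, Finset.mem_filter, Finset.mem_univ, true_and]
  constructor
  · rintro ⟨-, rfl⟩
    exact div_mul_cancel₀ _ (hl i).ne'
  · intro hi
    refine ⟨hi ▸ mul_lt_mul_of_pos_right hpK (hl i), ?_⟩
    rw [← hi, mul_div_cancel_right₀ _ (hl i).ne']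

theorem tan_lt_tan_of_pi_div_two_lt {x y : ℝ} (hx : Real.pi / 2 < x) (hxy : x < y)
    (hy : y < Real.pi) : Real.tan x < Real.tan y := by
  rw [← Real.tan_sub_pi x, ← Real.tan_sub_pi y]
  exact Real.tan_lt_tan_of_lt_of_lt_pi_div_two (by linarith) (by linarith) (by linarith)

variable {K : ℝ}

/-- Between poles the secular function is strictly increasing. -/
theorem tanSum_lt_tanSum [Nonempty ι] (hl : ∀ i, 0 < l i) (hK : ∀ i, K * l i < Real.pi) {x y : ℝ}
    (hx : 0 < x) (hxy : x < y) (hy : y ≤ K) (hnp : ∀ p ∈ Set.Icc x y, poleIndices l p = ∅) :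
    tanSum l x < tanSum l y := by
  refine Finset.sum_lt_sum_of_nonempty Finset.univ_nonempty fun i _ => ?_
  have hxi : 0 < x * l i := mul_pos hx (hl i)
  have hxyi : x * l i < y * l i := mul_lt_mul_of_pos_right hxy (hl i)
  have hyi : y * l i < Real.pi := (mul_le_mul_of_nonneg_right hy (hl i).le).trans_lt (hK i)
  rcases lt_or_ge (Real.pi / 2) (x * l i) with h | h
  · exact tan_lt_tan_of_pi_div_two_lt h hxyi hyi
  · rcases lt_or_ge (y * l i) (Real.pi / 2) with h' | h'
    · exact Real.tan_lt_tan_of_lt_of_lt_pi_div_two (by linarith) h' hxyi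
    · refine absurd (div_mul_cancel₀ (Real.pi / 2) (hl i).ne')
        (ne_pi_div_two_of_poleIndices_eq_empty (hnp (Real.pi / 2 / l i) ⟨?_, ?_⟩) i)
      · exact (le_div_iff₀ (hl i)).2 h
      · exact (div_le_iff₀ (hl i)).2 h'

theorem exists_pole_between_zeros [Nonempty ι] (hl : ∀ i, 0 < l i) (hK : ∀ i, K * l i < Real.pi)
    {x y : ℝ} (hx : x ∈ zeros l K) (hy : y ∈ zeros l K) (hxy : x < y) :
    ∃ p ∈ poles l K, x < p ∧ p < y := by
  by_contra! hcon
  have := tanSum_lt_tanSum hl hK hx.1.1 hxy hy.1.2 (by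
    intro p hp
    by_contra hne
    rcases hp.1.eq_or_lt with rfl | h1
    · exact hne hx.2.1
    rcases hp.2.eq_or_lt with rfl | h2
    · exact hne hy.2.1
    have := hcon p ((mem_poles hl).2 ⟨h2.trans_le hy.1.2, Finset.nonempty_iff_ne_empty.2 hne⟩) h1
    linarith)
  rw [hx.2.2, hy.2.2] at this
  exact lt_irrefl _ this

theorem exists_pole_lt_zero [Nonempty ι] (hl : ∀ i, 0 < l i) {x : ℝ} (hx : x ∈ zeros l K) :
    ∃ p ∈ poles l K, p < x := by
  by_contra! hcon
  have : 0 < tanSum l x := by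
    refine Finset.sum_pos (fun i _ => ?_) Finset.univ_nonempty
    refine Real.tan_pos_of_pos_of_lt_pi_div_two (mul_pos hx.1.1 (hl i)) ?_
    by_contra! h
    have h' : Real.pi / 2 < x * l i :=
      h.lt_of_ne (ne_pi_div_two_of_poleIndices_eq_empty hx.2.1 i).symm
    have hlt : Real.pi / 2 / l i < x := (div_lt_iff₀ (hl i)).2 h'
    have := hcon (Real.pi / 2 / l i) ((mem_poles hl).2 ⟨hlt.trans_le hx.1.2, i, by
      simp [poleIndices, div_mul_cancel₀ _ (hl i).ne']⟩)
    linarith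
  exact this.ne' hx.2.2

theorem tendsto_tanSum_atTop (hl : ∀ i, 0 < l i) (hK : ∀ i, K * l i < Real.pi) {p : ℝ}
    (hp : p ∈ poles l K) :
    Filter.Tendsto (tanSum l) (nhdsWithin p (Set.Iio p)) Filter.atTop := by
  classical
  obtain ⟨hpK, i₀, hi₀⟩ := (mem_poles hl).1 hp
  have key : ∀ i, p * l i = Real.pi / 2 → Filter.Tendsto (fun κ => Real.tan (κ * l i))
      (nhdsWithin p (Set.Iio p)) Filter.atTop := by
    intro i hi
    refine Real.tendsto_tan_pi_div_two.comp (tendsto_nhdsWithin_iff.2 ⟨?_, ?_⟩)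
    · rw [← hi]
      exact ((continuous_id.mul continuous_const).tendsto p).mono_left nhdsWithin_le_nhds
    · filter_upwards [self_mem_nhdsWithin] with κ hκ
      rw [← hi]
      exact mul_lt_mul_of_pos_right hκ (hl i)
  refine Filter.tendsto_sum_atTop_of_exists Finset.univ _ (fun i _ => ?_) (Finset.mem_univ i₀)
    (key i₀ (by simpa [poleIndices] using hi₀))
  by_cases hi : p * l i = Real.pi / 2
  · exact Or.inl (key i hi)
  · exact Or.inr ⟨_, (continuousAt_tan_mul hl hK (pos_of_mem_poles hl hp) hpK.le hi).tendsto.mono_left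
      nhdsWithin_le_nhds⟩

theorem tendsto_tanSum_atBot (hl : ∀ i, 0 < l i) (hK : ∀ i, K * l i < Real.pi) {p : ℝ}
    (hp : p ∈ poles l K) :
    Filter.Tendsto (tanSum l) (nhdsWithin p (Set.Ioi p)) Filter.atBot := by
  classical
  obtain ⟨hpK, i₀, hi₀⟩ := (mem_poles hl).1 hp
  have key : ∀ i, p * l i = Real.pi / 2 → Filter.Tendsto (fun κ => -Real.tan (κ * l i))
      (nhdsWithin p (Set.Ioi p)) Filter.atTop := by
    intro i hi
    refine (Real.tendsto_tan_pi_div_two.comp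
      (f := fun κ => Real.pi - κ * l i) (tendsto_nhdsWithin_iff.2 ⟨?_, ?_⟩)).congr fun κ => ?_
    · have : Filter.Tendsto (fun κ => Real.pi - κ * l i) (nhds p)
          (nhds (Real.pi - p * l i)) := Continuous.tendsto (by fun_prop) p
      rw [hi, sub_half] at this
      exact this.mono_left nhdsWithin_le_nhds
    · filter_upwards [self_mem_nhdsWithin] with κ hκ
      have : p * l i < κ * l i := mul_lt_mul_of_pos_right hκ (hl i)
      simp only [Set.mem_Iio]
      linarith
    · exact Real.tan_pi_sub _
  have := Filter.tendsto_sum_atTop_of_exists Finset.univ (fun i κ => -Real.tan (κ * l i))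
    (L := nhdsWithin p (Set.Ioi p)) (fun i _ => ?_) (Finset.mem_univ i₀)
    (key i₀ (by simpa [poleIndices] using hi₀))
  · rw [← Filter.tendsto_neg_atTop_iff]
    simpa [tanSum] using this
  by_cases hi : p * l i = Real.pi / 2
  · exact Or.inl (key i hi)
  · exact Or.inr ⟨_, (continuousAt_tan_mul hl hK (pos_of_mem_poles hl hp)
      hpK.le hi).neg.tendsto.mono_left nhdsWithin_le_nhds⟩

/-- Between consecutive poles the secular function increases from `-∞` to `∞`. -/
theorem exists_zero_between_poles (hl : ∀ i, 0 < l i) (hK : ∀ i, K * l i < Real.pi) {p q : ℝ}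
    (hp : p ∈ poles l K) (hq : q ∈ poles l K) (hpq : p < q)
    (hno : ∀ r ∈ poles l K, p < r → q ≤ r) : ∃ z ∈ zeros l K, p < z ∧ z < q := by
  have hqK := ((mem_poles hl).1 hq).1
  have hempty : ∀ x ∈ Set.Ioo p q, poleIndices l x = ∅ := by
    intro x hx
    by_contra hne
    have := hno x ((mem_poles hl).2 ⟨hx.2.trans hqK, Finset.nonempty_iff_ne_empty.2 hne⟩) hx.1
    exact absurd hx.2 (not_lt.2 this)
  have hp0 := pos_of_mem_poles hl hp
  have hcont : ContinuousOn (tanSum l) (Set.Ioo p q) := by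
    intro x hx
    refine ContinuousAt.continuousWithinAt ?_
    unfold tanSum
    exact tendsto_finsetSum _ fun i _ => continuousAt_tan_mul hl hK (hp0.trans hx.1)
      (hx.2.trans hqK).le (ne_pi_div_two_of_poleIndices_eq_empty (hempty x hx) i)
  obtain ⟨z, hz, hz0⟩ := (isPreconnected_Ioo (a := p) (b := q)).intermediate_value_Iii
    (l₁ := nhdsWithin p (Set.Ioi p)) (l₂ := nhdsWithin q (Set.Iio q))
    (Filter.le_principal_iff.2 (Ioo_mem_nhdsGT hpq))
    (Filter.le_principal_iff.2 (Ioo_mem_nhdsLT hpq)) hcont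
    (tendsto_tanSum_atBot hl hK hp) (tendsto_tanSum_atTop hl hK hq) (Set.mem_univ (0 : ℝ))
  exact ⟨z, ⟨⟨hp0.trans hz.1, (hz.2.trans hqK).le⟩, hempty z hz, hz0⟩, hz.1, hz.2⟩

/-- If `K` is itself a zero, then the zeros in `(0, K]` interlace with the poles in `(0, K)`, each
zero corresponding to the last pole before it. -/
theorem zeros_finite_and_ncard [Nonempty ι] (hl : ∀ i, 0 < l i) (hK : ∀ i, K * l i < Real.pi)
    (hKz : K ∈ zeros l K) : (zeros l K).Finite ∧ (zeros l K).ncard = (poles l K).card := by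
  classical
  have hex : ∀ z ∈ zeros l K, ∃ p ∈ poles l K, p < z ∧ ∀ r ∈ poles l K, r < z → r ≤ p := by
    intro z hz
    obtain ⟨p, hp, hpz⟩ := exists_pole_lt_zero hl hz
    have hne : ((poles l K).filter (· < z)).Nonempty := ⟨p, Finset.mem_filter.2 ⟨hp, hpz⟩⟩
    have hmem := Finset.mem_filter.1 (Finset.max'_mem _ hne)
    exact ⟨_, hmem.1, hmem.2, fun r hr hrz => Finset.le_max' _ _ (Finset.mem_filter.2 ⟨hr, hrz⟩)⟩
  choose! lastPole hπ hlt hmax using hex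
  have hinj : Set.InjOn lastPole (zeros l K) := by
    intro x hx y hy hxy
    by_contra hne
    rcases lt_or_gt_of_ne hne with h | h
    · obtain ⟨p, hp, h1, h2⟩ := exists_pole_between_zeros hl hK hx hy h
      linarith [hmax y hy p hp h2, hlt x hx]
    · obtain ⟨p, hp, h1, h2⟩ := exists_pole_between_zeros hl hK hy hx h
      linarith [hmax x hx p hp h2, hlt y hy]
  have himg : lastPole '' zeros l K = poles l K := by
    refine Set.Subset.antisymm (by rintro _ ⟨z, hz, rfl⟩; exact hπ z hz) fun p hp => ?_
    have hpK := ((mem_poles hl).1 hp).1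
    by_cases hne : ((poles l K).filter (p < ·)).Nonempty
    · have hmem := Finset.mem_filter.1 (Finset.min'_mem _ hne)
      have hmin : ∀ r ∈ poles l K, p < r → ((poles l K).filter (p < ·)).min' hne ≤ r :=
        fun r hr hpr => Finset.min'_le _ _ (Finset.mem_filter.2 ⟨hr, hpr⟩)
      obtain ⟨z, hz, h1, h2⟩ := exists_zero_between_poles hl hK hp hmem.1 hmem.2 hmin
      refine ⟨z, hz, le_antisymm (not_lt.1 fun h => ?_) (hmax z hz p hp h1)⟩
      linarith [hmin _ (hπ z hz) h, hlt z hz]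
    · refine ⟨K, hKz, le_antisymm (not_lt.1 fun h => ?_) (hmax K hKz p hp hpK)⟩
      exact hne ⟨_, Finset.mem_filter.2 ⟨hπ K hKz, h⟩⟩
  constructor
  · exact Set.Finite.of_finite_image (himg ▸ (poles l K).finite_toSet) hinj
  · rw [← hinj.ncard_image, himg, Set.ncard_coe_finset]

end TanSum

/-! ### The space of admissible amplitudes on a star graph -/

namespace TanSum

variable {ι : Type*} [Fintype ι] (l : ι → ℝ)

/-- The amplitudes `c` for which the waves `c i * cos (κ * x)`, with `x` the distance from the
leaf of the edge `i`, satisfy the vertex conditions at the centre of the star graph with edge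
lengths `l`. -/
def amplitudes (κ : ℝ) : Submodule ℂ (ι → ℂ) where
  carrier := {c | (∀ i j, c i * (Real.cos (κ * l i) : ℂ) = c j * (Real.cos (κ * l j) : ℂ)) ∧
    ∑ i, c i * (Real.sin (κ * l i) : ℂ) = 0}
  add_mem' := by
    rintro a b ⟨ha, ha'⟩ ⟨hb, hb'⟩
    refine ⟨fun i j => ?_, ?_⟩
    · simp only [Pi.add_apply, add_mul]
      rw [ha i j, hb i j]
    · simp only [Pi.add_apply, add_mul, Finset.sum_add_distrib]
      rw [ha', hb', add_zero]
  zero_mem' := by simp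
  smul_mem' := by
    rintro r a ⟨ha, ha'⟩
    refine ⟨fun i j => ?_, ?_⟩
    · simp only [Pi.smul_apply, smul_eq_mul, mul_assoc]
      rw [ha i j]
    · simp only [Pi.smul_apply, smul_eq_mul, mul_assoc, ← Finset.mul_sum]
      rw [ha', mul_zero]

variable {l} {K κ : ℝ}

theorem cos_mul_ne_zero (hl : ∀ i, 0 < l i) (hK : ∀ i, K * l i < Real.pi) (h0 : 0 < κ)
    (hκ : κ ≤ K) (hJ : poleIndices l κ = ∅) (i : ι) : Real.cos (κ * l i) ≠ 0 :=
  cos_ne_zero_of_mem_Ioo (mul_pos h0 (hl i))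
    ((mul_le_mul_of_nonneg_right hκ (hl i).le).trans_lt (hK i))
    (ne_pi_div_two_of_poleIndices_eq_empty hJ i)

theorem amplitudes_eq_tan (hcos : ∀ i, Real.cos (κ * l i) ≠ 0) {c : ι → ℂ}
    (hc : c ∈ amplitudes l κ) (i₀ : ι) :
    (∀ i, c i = c i₀ * (Real.cos (κ * l i₀) : ℂ) * (Real.cos (κ * l i) : ℂ)⁻¹) ∧
      c i₀ * (Real.cos (κ * l i₀) : ℂ) * (tanSum l κ : ℂ) = 0 := by
  have hcos' : ∀ i, (Real.cos (κ * l i) : ℂ) ≠ 0 := fun i => by exact_mod_cast hcos i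
  have h1 : ∀ i, c i = c i₀ * (Real.cos (κ * l i₀) : ℂ) * (Real.cos (κ * l i) : ℂ)⁻¹ := by
    intro i
    rw [← hc.1 i i₀, mul_inv_cancel_right₀ (hcos' i)]
  refine ⟨h1, ?_⟩
  rw [← hc.2, tanSum, Complex.ofReal_sum, Finset.mul_sum]
  refine Finset.sum_congr rfl fun i _ => ?_
  conv_rhs => rw [h1 i]
  rw [Real.tan_eq_sin_div_cos, Complex.ofReal_div]
  ring

theorem amplitudes_eq_bot (hcos : ∀ i, Real.cos (κ * l i) ≠ 0) (hF : tanSum l κ ≠ 0) :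
    amplitudes l κ = ⊥ := by
  rw [Submodule.eq_bot_iff]
  intro c hc
  funext i
  have h := (amplitudes_eq_tan hcos hc i).2
  have hcos' : (Real.cos (κ * l i) : ℂ) ≠ 0 := by exact_mod_cast hcos i
  have hF' : (tanSum l κ : ℂ) ≠ 0 := by exact_mod_cast hF
  exact (mul_eq_zero.1 ((mul_eq_zero.1 h).resolve_right hF')).resolve_right hcos'

theorem finrank_amplitudes_of_zero [Nonempty ι] (hcos : ∀ i, Real.cos (κ * l i) ≠ 0)
    (hF : tanSum l κ = 0) : Module.finrank ℂ (amplitudes l κ) = 1 := by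
  have hcos' : ∀ i, (Real.cos (κ * l i) : ℂ) ≠ 0 := fun i => by exact_mod_cast hcos i
  have hspan : amplitudes l κ
      = Submodule.span ℂ {(fun i => (Real.cos (κ * l i) : ℂ)⁻¹ : ι → ℂ)} := by
    refine le_antisymm (fun c hc => ?_) ?_
    · refine Submodule.mem_span_singleton.2
        ⟨c (Classical.arbitrary ι) * (Real.cos (κ * l (Classical.arbitrary ι)) : ℂ), ?_⟩
      funext i
      exact ((amplitudes_eq_tan hcos hc _).1 i).symm
    · rw [Submodule.span_singleton_le_iff_mem]
      refine ⟨fun i j => by rw [inv_mul_cancel₀ (hcos' i), inv_mul_cancel₀ (hcos' j)], ?_⟩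
      rw [← Complex.ofReal_zero, ← hF, tanSum, Complex.ofReal_sum]
      refine Finset.sum_congr rfl fun i _ => ?_
      rw [Real.tan_eq_sin_div_cos, Complex.ofReal_div, div_eq_inv_mul]
  rw [hspan]
  refine finrank_span_singleton fun h => ?_
  exact inv_ne_zero (hcos' (Classical.arbitrary ι)) (congrFun h _)

/-- At a pole every solution vanishes at the centre, so it is supported on the edges whose length
is a quarter of the wavelength, where the amplitudes add up to zero. -/
theorem finrank_amplitudes_of_pole (hl : ∀ i, 0 < l i) (hK : ∀ i, K * l i < Real.pi) (h0 : 0 < κ)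
    (hκ : κ ≤ K) (hJ : (poleIndices l κ).Nonempty) :
    Module.finrank ℂ (amplitudes l κ) + 1 = (poleIndices l κ).card := by
  classical
  set J := poleIndices l κ with hJdef
  have hmem : ∀ i, i ∈ J ↔ κ * l i = Real.pi / 2 := fun i => by simp [hJdef, poleIndices]
  let φ : Module.Dual ℂ (J → ℂ) := ∑ i : J, LinearMap.proj i
  have hφ : ∀ a, φ a = ∑ i, a i := fun a => by simp [φ]
  let ext : (J → ℂ) →ₗ[ℂ] (ι → ℂ) := Function.ExtendByZero.linearMap ℂ (Subtype.val : J → ι)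
  have hext : ∀ a (i : J), ext a i = a i := fun a i =>
    Subtype.val_injective.extend_apply a (0 : ι → ℂ) i
  have hext' : ∀ a, ∀ i ∉ J, ext a i = 0 := fun a i hi =>
    Function.extend_apply' a (0 : ι → ℂ) i (by rintro ⟨j, h⟩; exact hi (h ▸ j.2))
  have hinj : Function.Injective ext := by
    intro a b hab
    funext i
    rw [← hext a i, ← hext b i, hab]
  have hsum : ∀ c : ι → ℂ, (∀ i ∉ J, c i = 0) →
      ∑ i, c i * (Real.sin (κ * l i) : ℂ) = ∑ i : J, c i := by
    intro c hc
    rw [Finset.sum_coe_sort J c, ← Finset.sum_subset (Finset.subset_univ J)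
      (fun i _ hi => by rw [hc i hi, zero_mul])]
    refine Finset.sum_congr rfl fun i hi => ?_
    rw [(hmem i).1 hi, Real.sin_pi_div_two, Complex.ofReal_one, mul_one]
  have hcosJ : ∀ i ∈ J, (Real.cos (κ * l i) : ℂ) = 0 := fun i hi => by
    rw [(hmem i).1 hi, Real.cos_pi_div_two, Complex.ofReal_zero]
  have hmap : amplitudes l κ = (LinearMap.ker φ).map ext := by
    refine le_antisymm (fun c hc => ?_) ?_
    · obtain ⟨i₀, hi₀⟩ := hJ
      have hz : ∀ i ∉ J, c i = 0 := by
        intro i hi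
        have hcos : (Real.cos (κ * l i) : ℂ) ≠ 0 := by
          exact_mod_cast cos_ne_zero_of_mem_Ioo (mul_pos h0 (hl i))
            ((mul_le_mul_of_nonneg_right hκ (hl i).le).trans_lt (hK i)) (fun h => hi ((hmem i).2 h))
        have := hc.1 i i₀
        rw [hcosJ i₀ hi₀, mul_zero] at this
        exact (mul_eq_zero.1 this).resolve_right hcos
      refine ⟨fun i => c i, ?_, ?_⟩
      · rw [SetLike.mem_coe, LinearMap.mem_ker, hφ, ← hsum c hz]
        exact hc.2
      · funext i
        by_cases hi : i ∈ J
        · exact hext _ ⟨i, hi⟩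
        · rw [hext' _ i hi, hz i hi]
    · rintro _ ⟨a, ha, rfl⟩
      have hval : ∀ i, ext a i * (Real.cos (κ * l i) : ℂ) = 0 := by
        intro i
        by_cases hi : i ∈ J
        · rw [hcosJ i hi, mul_zero]
        · rw [hext' a i hi, zero_mul]
      refine ⟨fun i j => by rw [hval i, hval j], ?_⟩
      rw [hsum _ (hext' a), ← LinearMap.mem_ker.1 ha, hφ]
      exact Finset.sum_congr rfl fun i _ => hext a i
  have hφ0 : φ ≠ 0 := by
    obtain ⟨i₀, hi₀⟩ := hJ
    intro h
    have := hφ (Pi.single ⟨i₀, hi₀⟩ 1)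
    rw [h, Finset.sum_pi_single'] at this
    simp at this
  rw [hmap, ← (Submodule.equivMapOfInjective ext hinj (LinearMap.ker φ)).finrank_eq,
    Module.Dual.finrank_ker_add_one_of_ne_zero hφ0, Module.finrank_fintype_fun_eq_card,
    Fintype.card_coe]

end TanSum

/-! ### The spectrum of a star graph -/

namespace MetricGraph

variable {V E : Type*}

theorem endValue_outDeriv_of_eqOn_trig (G : MetricGraph V E) {κ : ℝ} {f : E → ℝ → ℂ} {e : E}
    {a b : ℂ} (hf : ∀ x ∈ Set.Icc 0 (G.len e),
      f e x = a * (Real.cos (κ * x) : ℂ) + b * (Real.sin (κ * x) : ℂ)) :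
    G.endValue f (e, false) = a ∧
    G.endValue f (e, true)
      = a * (Real.cos (κ * G.len e) : ℂ) + b * (Real.sin (κ * G.len e) : ℂ) ∧
    G.outDeriv f (e, false) = κ * b ∧
    G.outDeriv f (e, true)
      = κ * (a * (Real.sin (κ * G.len e) : ℂ) - b * (Real.cos (κ * G.len e) : ℂ)) := by
  have h0 : (0 : ℝ) ∈ Set.Icc 0 (G.len e) := ⟨le_rfl, (G.len_pos e).le⟩
  have h1 : G.len e ∈ Set.Icc 0 (G.len e) := ⟨(G.len_pos e).le, le_rfl⟩
  refine ⟨?_, hf _ h1, ?_, ?_⟩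
  · simpa [endValue] using hf 0 h0
  · simp [outDeriv, edgeDeriv, (derivWithin_eq_of_eqOn_trig (G.len_pos e) hf h0).2]
  · rw [outDeriv, edgeDeriv, (derivWithin_eq_of_eqOn_trig (G.len_pos e) hf h1).2]
    ring

theorem mem_edgesAt [Fintype E] (G : MetricGraph V E) {v : V} {d : E × Bool} :
    d ∈ G.edgesAt v ↔ G.ends d.1 d.2 = v := by
  simp [edgesAt]

/-- `G` is a star graph with centre `c`: the end `side e` of every edge `e` is the centre, and the
other ends of the edges are pairwise distinct vertices. -/
structure IsStar (G : MetricGraph V E) (c : V) (side : E → Bool) : Prop where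
  center : ∀ e, G.ends e (side e) = c
  leaf_ne : ∀ e, G.ends e (!side e) ≠ c
  leaf_injective : Function.Injective fun e => G.ends e (!side e)

variable (G : MetricGraph V E) (side : E → Bool)

open Classical in
/-- The function which on the edge `e` is `a e * cos (κ * x)`, where `x` is the distance from the
end of `e` opposite to `side e`. -/
noncomputable def starWave (κ : ℝ) : (E → ℂ) →ₗ[ℂ] (E → ℝ → ℂ) where
  toFun a e x := if x ∈ Set.Icc 0 (G.len e) then
    a e * (Real.cos (κ * if side e then x else G.len e - x) : ℂ) else 0
  map_add' a b := by
    funext e x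
    simp only [Pi.add_apply]
    split_ifs <;> ring
  map_smul' r a := by
    funext e x
    simp only [Pi.smul_apply, smul_eq_mul, RingHom.id_apply]
    split_ifs <;> ring

variable {G : MetricGraph V E} {side : E → Bool}

theorem starWave_eq_trig (κ : ℝ) (a : E → ℂ) (e : E) :
    ∀ x ∈ Set.Icc 0 (G.len e), G.starWave side κ a e x
      = (a e * if side e then 1 else (Real.cos (κ * G.len e) : ℂ)) * (Real.cos (κ * x) : ℂ)
        + (a e * if side e then 0 else (Real.sin (κ * G.len e) : ℂ)) * (Real.sin (κ * x) : ℂ) := by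
  intro x hx
  simp only [starWave, LinearMap.coe_mk, AddHom.coe_mk, if_pos hx]
  cases side e
  · simp only [Bool.false_eq_true, if_false, mul_sub, Real.cos_sub]
    push_cast
    ring
  · simp

theorem starWave_injective (κ : ℝ) : Function.Injective (G.starWave side κ) := by
  intro a b hab
  funext e
  cases hs : side e
  · simpa [starWave, hs, (G.len_pos e).le] using congrFun (congrFun hab e) (G.len e)
  · simpa [starWave, hs, (G.len_pos e).le] using congrFun (congrFun hab e) 0

theorem starWave_ends (κ : ℝ) (a : E → ℂ) (e : E) :
    G.endValue (G.starWave side κ a) (e, side e) = a e * (Real.cos (κ * G.len e) : ℂ) ∧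
    G.outDeriv (G.starWave side κ a) (e, side e) = κ * (a e * (Real.sin (κ * G.len e) : ℂ)) ∧
    G.outDeriv (G.starWave side κ a) (e, !side e) = 0 := by
  obtain ⟨h1, h2, h3, h4⟩ := G.endValue_outDeriv_of_eqOn_trig (starWave_eq_trig (side := side) κ a e)
  cases hs : side e
  · simp only [hs, Bool.false_eq_true, if_false, Bool.not_false] at h1 h2 h3 h4 ⊢
    exact ⟨h1, h3, by rw [h4]; ring⟩
  · simp only [hs, if_true, Bool.not_true] at h1 h2 h3 h4 ⊢
    exact ⟨by rw [h2]; ring, by rw [h4]; ring, by rw [h3]; ring⟩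

variable [Fintype E] {c : V}

theorem IsStar.mem_edgesAt_center (hG : G.IsStar c side) {d : E × Bool} :
    d ∈ G.edgesAt c ↔ d.2 = side d.1 := by
  rw [mem_edgesAt]
  constructor
  · intro h
    by_contra hne
    have : d.2 = !side d.1 := by rw [Bool.eq_not]; exact hne
    exact hG.leaf_ne d.1 (this ▸ h)
  · intro h
    rw [h, hG.center]

theorem IsStar.edgesAt_leaf (hG : G.IsStar c side) (e : E) :
    G.edgesAt (G.ends e (!side e)) = {(e, !side e)} := by
  ext ⟨e', b⟩
  rw [mem_edgesAt, Finset.mem_singleton]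
  constructor
  · intro h
    have hb : b = !side e' := by
      rw [Bool.eq_not]
      rintro rfl
      exact hG.leaf_ne e (h ▸ hG.center e')
    subst hb
    obtain rfl := hG.leaf_injective h
    rfl
  · intro h
    obtain ⟨rfl, rfl⟩ := Prod.mk.inj h
    rfl

theorem IsStar.sum_edgesAt_center (hG : G.IsStar c side) (g : E × Bool → ℂ) :
    ∑ d ∈ G.edgesAt c, g d = ∑ e, g (e, side e) := by
  symm
  refine Finset.sum_bij (fun e _ => (e, side e)) (fun e _ => hG.mem_edgesAt_center.2 rfl)
    (fun e _ e' _ h => congrArg Prod.fst h) (fun d hd => ⟨d.1, Finset.mem_univ _, ?_⟩)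
    (fun _ _ => rfl)
  exact Prod.ext rfl (hG.mem_edgesAt_center.1 hd).symm

/-- The eigenfunctions of a star graph are the waves with vanishing derivative at the leaves
that satisfy the vertex conditions at the centre. -/
theorem IsStar.eigenspace_eq (hG : G.IsStar c side) {κ : ℝ} (hκ : 0 < κ) :
    G.eigenspace (κ ^ 2) = (TanSum.amplitudes G.len κ).map (G.starWave side κ) := by
  have hκ' : (κ : ℂ) ≠ 0 := by exact_mod_cast hκ.ne'
  have hcond : ∀ a, G.NeumannConditions (G.starWave side κ a) ↔
      a ∈ TanSum.amplitudes G.len κ := by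
    intro a
    constructor
    · intro h
      refine ⟨fun e e' => ?_, ?_⟩
      · rw [← (starWave_ends (side := side) κ a e).1, ← (starWave_ends (side := side) κ a e').1]
        exact h.continuous c _ (hG.mem_edgesAt_center.2 rfl) _ (hG.mem_edgesAt_center.2 rfl)
      · have := h.sum_zero c
        simp only [hG.sum_edgesAt_center, (starWave_ends κ a _).2.1, ← Finset.mul_sum] at this
        exact (mul_eq_zero.1 this).resolve_left hκ'
    · intro h
      have hleaf : ∀ v ≠ c, ∀ d ∈ G.edgesAt v, d.2 = !side d.1 := by
        intro v hv d hd
        rw [Bool.eq_not]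
        intro hd'
        rw [mem_edgesAt, hd', hG.center] at hd
        exact hv hd.symm
      refine ⟨fun v d hd d' hd' => ?_, fun v => ?_⟩
      · by_cases hv : v = c
        · subst hv
          obtain ⟨e, b⟩ := d
          obtain ⟨e', b'⟩ := d'
          obtain rfl : b = side e := hG.mem_edgesAt_center.1 hd
          obtain rfl : b' = side e' := hG.mem_edgesAt_center.1 hd'
          rw [(starWave_ends κ a e).1, (starWave_ends κ a e').1]
          exact h.1 e e'
        · obtain ⟨e, b⟩ := d
          obtain rfl : b = !side e := hleaf v hv _ hd
          obtain rfl : G.ends e (!side e) = v := G.mem_edgesAt.1 hd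
          rw [hG.edgesAt_leaf, Finset.mem_singleton] at hd'
          rw [hd']
      · by_cases hv : v = c
        · subst hv
          simp only [hG.sum_edgesAt_center, (starWave_ends κ a _).2.1, ← Finset.mul_sum]
          rw [h.2, mul_zero]
        · refine Finset.sum_eq_zero fun d hd => ?_
          obtain ⟨e, b⟩ := d
          obtain rfl : b = !side e := hleaf v hv _ hd
          exact (starWave_ends κ a e).2.2
  refine le_antisymm (fun f hf => ?_) ?_
  · obtain ⟨hsupp, hab, hN⟩ := (G.solvesEigen_sq_iff hκ f).1 hf
    have hex : ∀ e, ∃ r : ℂ, ∀ x ∈ Set.Icc 0 (G.len e),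
        f e x = r * (Real.cos (κ * if side e then x else G.len e - x) : ℂ) := by
      intro e
      obtain ⟨a, b, h⟩ := hab e
      obtain ⟨h1, h2, h3, h4⟩ := G.endValue_outDeriv_of_eqOn_trig h
      have h0 := hN.sum_zero (G.ends e (!side e))
      rw [hG.edgesAt_leaf, Finset.sum_singleton] at h0
      cases hs : side e
      · rw [hs, Bool.not_false, h4] at h0
        have hz := (mul_eq_zero.1 h0).resolve_left hκ'
        refine ⟨a * (Real.cos (κ * G.len e) : ℂ) + b * (Real.sin (κ * G.len e) : ℂ),
          fun x hx => ?_⟩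
        have hsq : ((Real.sin (κ * G.len e) : ℂ)) ^ 2 + (Real.cos (κ * G.len e) : ℂ) ^ 2 = 1 := by
          exact_mod_cast Real.sin_sq_add_cos_sq (κ * G.len e)
        rw [h x hx]
        simp only [Bool.false_eq_true, if_false, mul_sub, Real.cos_sub]
        push_cast at hsq hz ⊢
        linear_combination (-a * Complex.cos (κ * x) - b * Complex.sin (κ * x)) * hsq
          + (Complex.sin (κ * G.len e) * Complex.cos (κ * x)
            - Complex.cos (κ * G.len e) * Complex.sin (κ * x)) * hz
      · rw [hs, Bool.not_true, h3] at h0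
        have hz := (mul_eq_zero.1 h0).resolve_left hκ'
        refine ⟨a, fun x hx => ?_⟩
        rw [h x hx, hz]
        simp
    choose r hr using hex
    have hf' : G.starWave side κ r = f := by
      funext e x
      by_cases hx : x ∈ Set.Icc 0 (G.len e)
      · rw [hr e x hx]
        simp only [starWave, LinearMap.coe_mk, AddHom.coe_mk, if_pos hx]
      · rw [hsupp e x hx]
        simp only [starWave, LinearMap.coe_mk, AddHom.coe_mk, if_neg hx]
    exact ⟨r, (hcond r).1 (hf' ▸ hN), hf'⟩
  · rintro _ ⟨a, ha, rfl⟩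
    refine (G.solvesEigen_sq_iff hκ _).2 ⟨fun e x hx => ?_, fun e => ⟨_, _, starWave_eq_trig κ a e⟩,
      (hcond a).2 ha⟩
    simp only [starWave, LinearMap.coe_mk, AddHom.coe_mk, if_neg hx]

theorem IsStar.finrank_eigenspace (hG : G.IsStar c side) {κ : ℝ} (hκ : 0 < κ) :
    Module.finrank ℂ (G.eigenspace (κ ^ 2)) = Module.finrank ℂ (TanSum.amplitudes G.len κ) ∧
      FiniteDimensional ℂ (G.eigenspace (κ ^ 2)) := by
  rw [hG.eigenspace_eq hκ]
  exact ⟨(Submodule.equivMapOfInjective _ (starWave_injective κ) _).finrank_eq.symm, inferInstance⟩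

/-- The spectral position of a star graph at the eigenvalue `K²`, when all edges are shorter than
half a wavelength: the number of edges longer than a quarter of a wavelength. A pole of the
secular function at which `m` edges are a quarter of a wavelength long contributes an eigenvalue
of multiplicity `m - 1`, and one more eigenvalue comes from the zero that follows the pole. -/
theorem IsStar.spectralCount_eq (hG : G.IsStar c side) {K : ℝ} (hK0 : 0 < K)
    (hK : ∀ e, K * G.len e < Real.pi) (hcos : ∀ e, Real.cos (K * G.len e) ≠ 0)
    (htan : ∑ e, Real.tan (K * G.len e) = 0) :
    G.SpectralCountFinite K ∧ G.spectralCount K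
      = (Finset.univ.filter (fun e => Real.pi / 2 < K * G.len e)).card := by
  classical
  have hfd : ∀ lam ∈ Set.Ioc 0 (K ^ 2), FiniteDimensional ℂ (G.eigenspace lam) := by
    intro lam hlam
    rw [← Real.sq_sqrt hlam.1.le]
    exact (hG.finrank_eigenspace (Real.sqrt_pos.2 hlam.1)).2
  have hrank : ∀ lam, G.eigenspace lam = ⊥ → Module.finrank ℂ (G.eigenspace lam) = 0 :=
    fun lam h => by rw [h]; exact finrank_bot ℂ _
  -- Without edges every function is zero; there the secular function vanishes identically, so its
  -- zeros do not describe the spectrum.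
  rcases isEmpty_or_nonempty E with hE | hE
  · have hbot : ∀ lam, G.eigenspace lam = ⊥ := fun lam =>
      (Submodule.eq_bot_iff _).2 fun f _ => Subsingleton.elim _ _
    refine ⟨⟨?_, hfd⟩, ?_⟩
    · simp [IsEigenvalue, hbot]
    · simp [spectralCount, hrank _ (hbot _)]
  have hl := G.len_pos
  have hpoleK : TanSum.poleIndices G.len K = ∅ := by
    refine Finset.eq_empty_of_forall_notMem fun e he => hcos e ?_
    have : K * G.len e = Real.pi / 2 := by simpa [TanSum.poleIndices] using he
    rw [this, Real.cos_pi_div_two]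
  have hKz : K ∈ TanSum.zeros G.len K := ⟨⟨hK0, le_rfl⟩, hpoleK, htan⟩
  obtain ⟨hfin, hcard⟩ := TanSum.zeros_finite_and_ncard hl hK hKz
  set Z := hfin.toFinset with hZ
  set P := TanSum.poles G.len K with hP
  have hZmem : ∀ κ, κ ∈ Z ↔ κ ∈ TanSum.zeros G.len K := fun κ => hfin.mem_toFinset
  have hpos : ∀ κ ∈ Z ∪ P, 0 < κ := by
    intro κ hκ
    rcases Finset.mem_union.1 hκ with h | h
    · exact ((hZmem κ).1 h).1.1
    · exact TanSum.pos_of_mem_poles hl h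
  have hle : ∀ κ ∈ Z ∪ P, κ ≤ K := by
    intro κ hκ
    rcases Finset.mem_union.1 hκ with h | h
    · exact ((hZmem κ).1 h).1.2
    · exact ((TanSum.mem_poles hl).1 h).1.le
  have hsub : ∀ lam ∈ Set.Ioc 0 (K ^ 2), G.IsEigenvalue lam → lam ∈ (Z ∪ P).image (· ^ 2) := by
    intro lam hlam hev
    have h0 := Real.sqrt_pos.2 hlam.1
    have hκK : Real.sqrt lam ≤ K := Real.sqrt_le_iff.2 ⟨hK0.le, hlam.2⟩
    refine Finset.mem_image.2 ⟨Real.sqrt lam, ?_, Real.sq_sqrt hlam.1.le⟩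
    by_cases hJ : TanSum.poleIndices G.len (Real.sqrt lam) = ∅
    · refine Finset.mem_union_left _ ((hZmem _).2 ⟨⟨h0, hκK⟩, hJ, ?_⟩)
      by_contra hF
      apply hev
      rw [← Real.sq_sqrt hlam.1.le, hG.eigenspace_eq h0,
        TanSum.amplitudes_eq_bot (TanSum.cos_mul_ne_zero hl hK h0 hκK hJ) hF, Submodule.map_bot]
    · refine Finset.mem_union_right _ ((TanSum.mem_poles hl).2
        ⟨hκK.lt_of_ne fun h => hJ (h ▸ hpoleK), Finset.nonempty_iff_ne_empty.2 hJ⟩)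
  refine ⟨⟨((Z ∪ P).image (· ^ 2)).finite_toSet.subset fun lam h => hsub lam h.1 h.2, hfd⟩, ?_⟩
  have hdisj : Disjoint Z P := by
    rw [Finset.disjoint_left]
    intro κ h1 h2
    exact ((TanSum.mem_poles hl).1 h2).2.ne_empty ((hZmem κ).1 h1).2.1
  have hsum : G.spectralCount K
      = ∑ lam ∈ (Z ∪ P).image (· ^ 2), Module.finrank ℂ (G.eigenspace lam) := by
    refine finsum_mem_eq_sum_of_inter_support_eq _ (Set.ext fun lam => ?_)
    constructor
    · rintro ⟨h1, h2⟩
      refine ⟨hsub lam h1 fun hbot => h2 (hrank lam hbot), h2⟩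
    · rintro ⟨h1, h2⟩
      obtain ⟨κ, hκ, rfl⟩ := Finset.mem_image.1 (Finset.mem_coe.1 h1)
      exact ⟨⟨pow_pos (hpos κ hκ) 2, pow_le_pow_left₀ (hpos κ hκ).le (hle κ hκ) 2⟩, h2⟩
  rw [hsum, Finset.sum_image fun x hx y hy h =>
      (pow_left_inj₀ (hpos x hx).le (hpos y hy).le two_ne_zero).1 h,
    Finset.sum_union hdisj, TanSum.card_pi_div_two_lt_eq_sum hl]
  have h1 : ∑ κ ∈ Z, Module.finrank ℂ (G.eigenspace (κ ^ 2)) = P.card := by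
    rw [← hcard, Set.ncard_eq_toFinset_card _ hfin, Finset.card_eq_sum_ones]
    refine Finset.sum_congr rfl fun κ hκ => ?_
    obtain ⟨⟨h0, hκK⟩, hJ, hF⟩ := (hZmem κ).1 hκ
    rw [(hG.finrank_eigenspace h0).1]
    exact TanSum.finrank_amplitudes_of_zero (TanSum.cos_mul_ne_zero hl hK h0 hκK hJ) hF
  rw [h1, Finset.card_eq_sum_ones, ← Finset.sum_add_distrib]
  refine Finset.sum_congr rfl fun p hp => ?_
  obtain ⟨hpK, hJ⟩ := (TanSum.mem_poles hl).1 hp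
  have h0 := TanSum.pos_of_mem_poles hl hp
  rw [(hG.finrank_eigenspace h0).1, ← TanSum.finrank_amplitudes_of_pole hl hK h0 hpK.le hJ, add_comm]

end MetricGraph

/-! ### The components of a cut graph -/

namespace MetricGraph

variable {V E : Type*}

theorem eq_of_reachable (G : MetricGraph V E) {α : Type*} (o : V → α)
    (h : ∀ e, o (G.ends e false) = o (G.ends e true)) {u w : V}
    (huw : G.toSimpleGraph.Reachable u w) : o u = o w := by
  obtain ⟨p⟩ := huw
  induction p with
  | nil => rfl
  | cons hadj _ ih =>
    rw [← ih]
    rcases ((SimpleGraph.fromRel_adj _ _ _).1 hadj).2 with ⟨e, rfl, rfl⟩ | ⟨e, rfl, rfl⟩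
    · exact h e
    · exact (h e).symm

/-- Every edge `e` carries a point of `P`; `first e` is the first one and `last e` the last one. -/
structure CutEnds (P : Finset (E × ℝ)) (first last : E → ℝ) : Prop where
  first_mem : ∀ e, (e, first e) ∈ P
  first_le : ∀ e x, (e, x) ∈ P → first e ≤ x
  last_mem : ∀ e, (e, last e) ∈ P
  le_last : ∀ e x, (e, x) ∈ P → x ≤ last e

variable {G : MetricGraph V E} {P : Finset (E × ℝ)} {first last : E → ℝ}

theorem CutEnds.piece_zero (C : CutEnds P first last)
    (hP : ∀ p ∈ P, p.2 ∈ Set.Ioo 0 (G.len p.1)) (e : E) :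
    G.pieceEnd P e 0 = first e ∧
      G.pieceEndVertex P e 0 = Sum.inr (⟨(e, first e), C.first_mem e⟩, false) := by
  have hmem : first e ∈ laterCuts P e 0 :=
    mem_laterCuts.2 ⟨C.first_mem e, (hP _ (C.first_mem e)).1⟩
  have hne : (laterCuts P e 0).Nonempty := ⟨_, hmem⟩
  have hmin : (laterCuts P e 0).min' hne = first e :=
    le_antisymm (Finset.min'_le _ _ hmem)
      (C.first_le e _ (mem_laterCuts.1 (Finset.min'_mem _ hne)).1)
  constructor
  · rw [pieceEnd, dif_pos hne, hmin]
  · simp only [pieceEndVertex, dif_pos hne, hmin]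

theorem CutEnds.piece_last (C : CutEnds P first last) (e : E) :
    G.pieceEnd P e (last e) = G.len e ∧
      G.pieceEndVertex P e (last e) = Sum.inl (G.ends e true) := by
  have hne : ¬ (laterCuts P e (last e)).Nonempty := by
    rintro ⟨x, hx⟩
    have := mem_laterCuts.1 hx
    exact absurd (C.le_last e x this.1) (not_le.2 this.2)
  constructor
  · rw [pieceEnd, dif_neg hne]
  · simp only [pieceEndVertex, dif_neg hne]

theorem CutEnds.piece_of_lt_last (C : CutEnds P first last) {e : E} {a : ℝ} (ha : a < last e) :
    ∃ y, ∃ h : (e, y) ∈ P, a < y ∧ G.pieceEndVertex P e a = Sum.inr (⟨(e, y), h⟩, false) := by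
  have hne : (laterCuts P e a).Nonempty := ⟨last e, mem_laterCuts.2 ⟨C.last_mem e, ha⟩⟩
  have hmem := mem_laterCuts.1 (Finset.min'_mem _ hne)
  exact ⟨_, hmem.1, hmem.2, by simp only [pieceEndVertex, dif_pos hne]⟩

open Classical in
/-- The vertex of the original graph in whose component a vertex of the cut graph lies, if there
is one. -/
noncomputable def cutOwner (G : MetricGraph V E) (P : Finset (E × ℝ)) (first last : E → ℝ) :
    V ⊕ (P × Bool) → Option V
  | Sum.inl v => some v
  | Sum.inr (p, false) => if p.1.2 = first p.1.1 then some (G.ends p.1.1 false) else none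
  | Sum.inr (p, true) => if p.1.2 = last p.1.1 then some (G.ends p.1.1 true) else none

theorem CutEnds.cutOwner_eq (C : CutEnds P first last)
    (hP : ∀ p ∈ P, p.2 ∈ Set.Ioo 0 (G.len p.1)) (e' : E ⊕ P) :
    G.cutOwner P first last ((G.cut P hP).ends e' false)
      = G.cutOwner P first last ((G.cut P hP).ends e' true) := by
  rcases e' with e | ⟨⟨e, a⟩, hp⟩
  · change some (G.ends e false) = G.cutOwner P first last (G.pieceEndVertex P e 0)
    rw [(C.piece_zero hP e).2]
    simp [cutOwner]
  · change (if a = last e then some (G.ends e true) else none)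
      = G.cutOwner P first last (G.pieceEndVertex P e a)
    by_cases ha : a = last e
    · subst ha
      rw [(C.piece_last e).2, if_pos rfl, cutOwner]
    · obtain ⟨y, hy, hay, hv⟩ := C.piece_of_lt_last (G := G) ((C.le_last e a hp).lt_of_ne ha)
      rw [hv, if_neg ha]
      have : y ≠ first e := ((C.first_le e a hp).trans_lt hay).ne'
      simp [cutOwner, this]

/-- The piece of the cut graph at an edge end of the original graph. -/
def CutEnds.endPiece (C : CutEnds P first last) : E × Bool → E ⊕ P
  | (e, false) => Sum.inl e
  | (e, true) => Sum.inr ⟨(e, last e), C.last_mem e⟩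

/-- The length of the piece of the cut graph at an edge end of the original graph. -/
def stubLength (G : MetricGraph V E) (first last : E → ℝ) : E × Bool → ℝ
  | (e, false) => first e
  | (e, true) => G.len e - last e

theorem CutEnds.len_endPiece (C : CutEnds P first last)
    (hP : ∀ p ∈ P, p.2 ∈ Set.Ioo 0 (G.len p.1)) (d : E × Bool) :
    (G.cut P hP).len (C.endPiece d) = G.stubLength first last d := by
  obtain ⟨e, _ | _⟩ := d
  · exact (C.piece_zero hP e).1
  · change G.pieceEnd P e (last e) - last e = G.len e - last e
    rw [(C.piece_last e).1]

theorem CutEnds.endPiece_injective (C : CutEnds P first last) :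
    Function.Injective C.endPiece := by
  rintro ⟨e, _ | _⟩ ⟨e', _ | _⟩ h
  · rw [Sum.inl.inj h]
  · exact absurd h Sum.inl_ne_inr
  · exact absurd h Sum.inr_ne_inl
  · have h' : e = e' := congrArg (fun p : P => p.1.1) (Sum.inr.inj h)
    rw [h']

/-- The end of an end piece which is the vertex of the original graph. -/
theorem CutEnds.ends_endPiece (C : CutEnds P first last)
    (hP : ∀ p ∈ P, p.2 ∈ Set.Ioo 0 (G.len p.1)) (d : E × Bool) :
    (G.cut P hP).ends (C.endPiece d) d.2 = Sum.inl (G.ends d.1 d.2) := by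
  obtain ⟨e, _ | _⟩ := d
  · rfl
  · exact (C.piece_last e).2

/-- The end of an end piece which is not a vertex of the original graph. -/
theorem CutEnds.ends_endPiece_not (C : CutEnds P first last)
    (hP : ∀ p ∈ P, p.2 ∈ Set.Ioo 0 (G.len p.1)) (e : E) :
    (G.cut P hP).ends (C.endPiece (e, false)) true
        = Sum.inr (⟨(e, first e), C.first_mem e⟩, false) ∧
      (G.cut P hP).ends (C.endPiece (e, true)) false
        = Sum.inr (⟨(e, last e), C.last_mem e⟩, true) :=
  ⟨(C.piece_zero hP e).2, rfl⟩

theorem CutEnds.reachable_iff (C : CutEnds P first last)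
    (hP : ∀ p ∈ P, p.2 ∈ Set.Ioo 0 (G.len p.1)) {v : V} {e' : E ⊕ P} :
    (G.cut P hP).toSimpleGraph.Reachable (Sum.inl v) ((G.cut P hP).ends e' false) ↔
      ∃ d, G.ends d.1 d.2 = v ∧ C.endPiece d = e' := by
  constructor
  · intro h
    have ho := (G.cut P hP).eq_of_reachable _ (C.cutOwner_eq hP) h
    rcases e' with e | ⟨⟨e, a⟩, hp⟩
    · exact ⟨(e, false), (Option.some.inj ho).symm, rfl⟩
    · change some v = if a = last e then some (G.ends e true) else none at ho
      split_ifs at ho with ha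
      subst ha
      exact ⟨(e, true), (Option.some.inj ho).symm, rfl⟩
  · rintro ⟨⟨e, _ | _⟩, rfl, rfl⟩
    · exact SimpleGraph.Reachable.refl _
    · rw [← C.ends_endPiece hP (e, true)]
      exact ((G.cut P hP).reachable_ends _).symm

/-- If every edge is cut, then the component of a vertex `v` is the star formed by the end pieces
at `v`. -/
theorem CutEnds.component_isStar (C : CutEnds P first last)
    (hP : ∀ p ∈ P, p.2 ∈ Set.Ioo 0 (G.len p.1)) (v : V) :
    ((G.cut P hP).component (Sum.inl v)).IsStar ⟨Sum.inl v, SimpleGraph.Reachable.refl _⟩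
      (fun e' => e'.1.isRight) := by
  have hside : ∀ d, (C.endPiece d).isRight = d.2 := by rintro ⟨e, _ | _⟩ <;> rfl
  refine ⟨?_, ?_, ?_⟩
  · rintro ⟨e', he'⟩
    obtain ⟨d, hd, rfl⟩ := (C.reachable_iff hP).1 he'
    refine Subtype.ext ?_
    change (G.cut P hP).ends (C.endPiece d) (C.endPiece d).isRight = _
    rw [hside, C.ends_endPiece hP, hd]
  · rintro ⟨e', he'⟩ h
    obtain ⟨d, hd, rfl⟩ := (C.reachable_iff hP).1 he'
    have h' : (G.cut P hP).ends (C.endPiece d) (!(C.endPiece d).isRight) = Sum.inl v :=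
      congrArg Subtype.val h
    rw [hside] at h'
    obtain ⟨e, _ | _⟩ := d
    · rw [Bool.not_false, (C.ends_endPiece_not hP e).1] at h'
      exact absurd h' Sum.inr_ne_inl
    · rw [Bool.not_true, (C.ends_endPiece_not hP e).2] at h'
      exact absurd h' Sum.inr_ne_inl
  · rintro ⟨e₁, he₁⟩ ⟨e₂, he₂⟩ h
    obtain ⟨d₁, hd₁, rfl⟩ := (C.reachable_iff hP).1 he₁
    obtain ⟨d₂, hd₂, rfl⟩ := (C.reachable_iff hP).1 he₂
    have h' : (G.cut P hP).ends (C.endPiece d₁) (!(C.endPiece d₁).isRight)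
        = (G.cut P hP).ends (C.endPiece d₂) (!(C.endPiece d₂).isRight) :=
      congrArg Subtype.val h
    rw [hside, hside] at h'
    refine Subtype.ext (congrArg C.endPiece ?_)
    obtain ⟨e, _ | _⟩ := d₁ <;> obtain ⟨e', _ | _⟩ := d₂
    all_goals
      simp only [Bool.not_false, Bool.not_true, (C.ends_endPiece_not hP _).1,
        (C.ends_endPiece_not hP _).2] at h'
      have h1 := Sum.inr.inj h'
      have h2 := congrArg Prod.snd h1
      have h3 := congrArg (fun q : P × Bool => q.1.1.1) h1
      simp at h2 h3
    · rw [h3]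
    · rw [h3]

theorem CutEnds.exists_equiv_edgesAt [Fintype E] (C : CutEnds P first last)
    (hP : ∀ p ∈ P, p.2 ∈ Set.Ioo 0 (G.len p.1)) (v : V) :
    ∃ φ : {d // d ∈ G.edgesAt v} ≃
        {e' // (G.cut P hP).toSimpleGraph.Reachable (Sum.inl v) ((G.cut P hP).ends e' false)},
      ∀ d, ((G.cut P hP).component (Sum.inl v)).len (φ d) = G.stubLength first last d := by
  refine ⟨Equiv.ofBijective (fun d => ⟨C.endPiece d.1,
    (C.reachable_iff hP).2 ⟨d.1, G.mem_edgesAt.1 d.2, rfl⟩⟩) ⟨?_, ?_⟩, fun d => ?_⟩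
  · intro d d' h
    exact Subtype.ext (C.endPiece_injective (congrArg Subtype.val h))
  · rintro ⟨e', he'⟩
    obtain ⟨d, hd, rfl⟩ := (C.reachable_iff hP).1 he'
    exact ⟨⟨d, G.mem_edgesAt.2 hd⟩, rfl⟩
  · exact C.len_endPiece hP d.1

end MetricGraph

/-! ### Zeros of a cosine wave on an interval -/

theorem Real.exists_phase (r : ℝ) : ∃ s ∈ Set.Ioc 0 Real.pi, ∃ A : ℝ, A ≠ 0 ∧
    ∀ y, Real.cos y + r * Real.sin y = A * Real.cos (y - s) := by
  have hc := Real.cos_arctan_pos r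
  have key : ∀ y, Real.cos y + r * Real.sin y
      = (Real.cos (Real.arctan r))⁻¹ * Real.cos (y - Real.arctan r) := by
    intro y
    have hs : Real.sin (Real.arctan r) = r * Real.cos (Real.arctan r) := by
      rw [← Real.tan_mul_cos hc.ne', Real.tan_arctan]
    rw [Real.cos_sub, hs]
    field_simp
  have h1 := Real.neg_pi_div_two_lt_arctan r
  have h2 := Real.arctan_lt_pi_div_two r
  rcases lt_or_ge 0 (Real.arctan r) with h | h
  · exact ⟨_, ⟨h, by linarith [Real.pi_pos]⟩, _, inv_ne_zero hc.ne', key⟩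
  · refine ⟨Real.arctan r + Real.pi, ⟨by linarith, by linarith⟩, -(Real.cos (Real.arctan r))⁻¹,
      neg_ne_zero.2 (inv_ne_zero hc.ne'), fun y => ?_⟩
    rw [key, ← sub_sub, Real.cos_sub_pi]
    ring

theorem Real.exists_eq_add_nat_mul_pi_add {s T : ℝ} (hs : s < T) :
    ∃ n : ℕ, ∃ t ∈ Set.Ioc 0 Real.pi, T = s + n * Real.pi + t := by
  obtain ⟨m, hm, -⟩ := existsUnique_add_zsmul_mem_Ioc Real.pi_pos (T - s) 0
  rw [zsmul_eq_mul, zero_add] at hm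
  have hm0 : m ≤ 0 := by
    by_contra! h
    have : (1 : ℝ) ≤ m := by exact_mod_cast h
    nlinarith [hm.2, Real.pi_pos]
  refine ⟨m.natAbs, _, hm, ?_⟩
  have : ((m.natAbs : ℕ) : ℝ) = -m := by
    rw [Nat.cast_natAbs, abs_of_nonpos hm0, Int.cast_neg]
  rw [this]
  ring

section Wave

variable {k l s t : ℝ} {n : ℕ}

theorem sin_wave_eq_zero_iff (hk : 0 < k) (hs : s ∈ Set.Ioc 0 Real.pi)
    (ht : t ∈ Set.Ioc 0 Real.pi) (hl : k * l = s + n * Real.pi + t) (x : ℝ) :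
    (x ∈ Set.Ioo 0 l ∧ Real.sin (k * x - s) = 0) ↔
      ∃ j : ℕ, j ≤ n ∧ x = (s + j * Real.pi) / k := by
  have hpi := Real.pi_pos
  constructor
  · rintro ⟨⟨hx0, hxl⟩, hx⟩
    obtain ⟨z, hz⟩ := Real.sin_eq_zero_iff.1 hx
    have h0 : 0 < k * x := mul_pos hk hx0
    have h1 : k * x < k * l := mul_lt_mul_of_pos_left hxl hk
    have hz0 : 0 ≤ z := by
      by_contra! h
      have : (z : ℝ) ≤ -1 := by exact_mod_cast Int.le_sub_one_of_lt h
      nlinarith [hs.2]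
    have hzn : z ≤ n := by
      by_contra! h
      have : (n : ℝ) + 1 ≤ z := by exact_mod_cast h
      nlinarith [ht.2]
    lift z to ℕ using hz0
    refine ⟨z, by exact_mod_cast hzn, ?_⟩
    rw [eq_div_iff hk.ne']
    push_cast at hz
    linarith
  · rintro ⟨j, hj, rfl⟩
    have hj' : (j : ℝ) * Real.pi ≤ n * Real.pi :=
      mul_le_mul_of_nonneg_right (by exact_mod_cast hj) hpi.le
    have hj0 : 0 ≤ (j : ℝ) * Real.pi := by positivity
    refine ⟨⟨div_pos (by linarith [hs.1]) hk, ?_⟩, ?_⟩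
    · rw [div_lt_iff₀ hk, mul_comm l k, hl]
      linarith [ht.1]
    · rw [mul_div_cancel₀ _ hk.ne', add_sub_cancel_left, Real.sin_nat_mul_pi]

theorem cos_wave_zeros (hk : 0 < k) (hs : s ∈ Set.Ioc 0 Real.pi)
    (ht : t ∈ Set.Ioc 0 Real.pi) (hl : k * l = s + n * Real.pi + t) :
    {x | x ∈ Set.Ioo 0 l ∧ Real.cos (k * x - s) = 0}.Finite ∧
    {x | x ∈ Set.Ioo 0 l ∧ Real.cos (k * x - s) = 0}.ncard
      = n + (if Real.pi / 2 < s then 1 else 0) + (if Real.pi / 2 < t then 1 else 0) := by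
  have hpi := Real.pi_pos
  -- The zeros are the points with `k * x = s + (z + 1/2) * π` for an integer `z` in `[A, B)`.
  set A : ℤ := if Real.pi / 2 < s then -1 else 0 with hA
  set B : ℤ := if Real.pi / 2 < t then n + 1 else n with hB
  have hlow : ∀ z : ℤ, 0 < s + (z + 1 / 2) * Real.pi ↔ A ≤ z := by
    intro z
    simp only [hA]
    split_ifs with h
    · constructor
      · intro hz
        by_contra! hlt
        have : (z : ℝ) ≤ -2 := by exact_mod_cast Int.le_sub_one_of_lt hlt
        nlinarith [hs.2]
      · intro hz
        have : (-1 : ℝ) ≤ z := by exact_mod_cast hz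
        nlinarith
    · constructor
      · intro hz
        by_contra! hlt
        have : (z : ℝ) ≤ -1 := by exact_mod_cast Int.le_sub_one_of_lt hlt
        nlinarith
      · intro hz
        have : (0 : ℝ) ≤ z := by exact_mod_cast hz
        nlinarith [hs.1]
  have hup : ∀ z : ℤ, s + (z + 1 / 2) * Real.pi < k * l ↔ z < B := by
    intro z
    rw [hl]
    simp only [hB]
    split_ifs with h
    · constructor
      · intro hz
        by_contra! hlt
        have : (n : ℝ) + 1 ≤ z := by exact_mod_cast hlt
        nlinarith [ht.2]
      · intro hz
        have : (z : ℝ) ≤ n := by exact_mod_cast Int.lt_add_one_iff.1 hz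
        nlinarith
    · constructor
      · intro hz
        by_contra! hlt
        have : (n : ℝ) ≤ z := by exact_mod_cast hlt
        nlinarith
      · intro hz
        have : (z : ℝ) + 1 ≤ n := by exact_mod_cast hz
        nlinarith [ht.1]
  have hset : {x | x ∈ Set.Ioo 0 l ∧ Real.cos (k * x - s) = 0}
      = (fun z : ℤ => (s + (z + 1 / 2) * Real.pi) / k) '' (Finset.Ico A B : Set ℤ) := by
    ext x
    simp only [Set.mem_ofPred_eq, Set.mem_image, Finset.coe_Ico]
    constructor
    · rintro ⟨⟨hx0, hxl⟩, hx⟩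
      obtain ⟨z, hz⟩ := Real.cos_eq_zero_iff.1 hx
      have hkx : s + (z + 1 / 2) * Real.pi = k * x := by linarith
      refine ⟨z, ⟨(hlow z).1 ?_, (hup z).1 ?_⟩, ?_⟩
      · rw [hkx]
        exact mul_pos hk hx0
      · rw [hkx]
        exact mul_lt_mul_of_pos_left hxl hk
      · rw [hkx, mul_div_cancel_left₀ _ hk.ne']
    · rintro ⟨z, ⟨h1, h2⟩, rfl⟩
      refine ⟨⟨div_pos ((hlow z).2 h1) hk, ?_⟩, Real.cos_eq_zero_iff.2 ⟨z, ?_⟩⟩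
      · rw [div_lt_iff₀ hk, mul_comm l k]
        exact (hup z).2 h2
      · rw [mul_div_cancel₀ _ hk.ne']
        ring
  have hinj : Function.Injective (fun z : ℤ => (s + (z + 1 / 2) * Real.pi) / k) := by
    intro z w h
    have h' : s + ((z : ℝ) + 1 / 2) * Real.pi = s + ((w : ℝ) + 1 / 2) * Real.pi :=
      (div_left_inj' hk.ne').1 h
    have := mul_right_cancel₀ hpi.ne' (add_left_cancel h')
    exact_mod_cast add_right_cancel this
  rw [hset]
  refine ⟨(Finset.finite_toSet _).image _, ?_⟩
  rw [hinj.injOn.ncard_image, Set.ncard_coe_finset, Int.card_Ico, hA, hB]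
  split_ifs <;> omega

end Wave

/-! ### A generic eigenfunction on an edge -/

namespace MetricGraph

variable {V E : Type*}

theorem endValue_conj (G : MetricGraph V E) (f : E → ℝ → ℂ) (d : E × Bool) :
    G.endValue (fun e x => (starRingEnd ℂ) (f e x)) d = (starRingEnd ℂ) (G.endValue f d) := by
  obtain ⟨e, _ | _⟩ := d <;> rfl

theorem SolvesEigen.conj [Fintype E] {G : MetricGraph V E} {κ : ℝ} (hκ : 0 < κ) {f : E → ℝ → ℂ}
    (hf : G.SolvesEigen (κ ^ 2) f) :
    G.SolvesEigen (κ ^ 2) (fun e x => (starRingEnd ℂ) (f e x)) := by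
  obtain ⟨h1, h2, h3⟩ := (G.solvesEigen_sq_iff hκ f).1 hf
  have h2' : ∀ e, ∀ a b : ℂ, (∀ x ∈ Set.Icc 0 (G.len e),
      f e x = a * (Real.cos (κ * x) : ℂ) + b * (Real.sin (κ * x) : ℂ)) →
      ∀ x ∈ Set.Icc 0 (G.len e), (starRingEnd ℂ) (f e x)
        = (starRingEnd ℂ) a * (Real.cos (κ * x) : ℂ)
          + (starRingEnd ℂ) b * (Real.sin (κ * x) : ℂ) := by
    intro e a b hab x hx
    rw [hab x hx, map_add, map_mul, map_mul, Complex.conj_ofReal, Complex.conj_ofReal]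
  have hout : ∀ d, G.outDeriv (fun e x => (starRingEnd ℂ) (f e x)) d
      = (starRingEnd ℂ) (G.outDeriv f d) := by
    rintro ⟨e, c⟩
    obtain ⟨a, b, hab⟩ := h2 e
    obtain ⟨-, -, h5, h6⟩ := G.endValue_outDeriv_of_eqOn_trig hab
    obtain ⟨-, -, h7, h8⟩ := G.endValue_outDeriv_of_eqOn_trig
      (f := fun e x => (starRingEnd ℂ) (f e x)) (h2' e a b hab)
    cases c
    · rw [h5, h7, map_mul, Complex.conj_ofReal]
    · rw [h6, h8, map_mul, map_sub, map_mul, map_mul, Complex.conj_ofReal, Complex.conj_ofReal,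
        Complex.conj_ofReal]
  refine (G.solvesEigen_sq_iff hκ _).2 ⟨fun e x hx => by rw [h1 e x hx, map_zero], fun e => ?_,
    fun v d hd d' hd' => ?_, fun v => ?_⟩
  · obtain ⟨a, b, hab⟩ := h2 e
    exact ⟨_, _, h2' e a b hab⟩
  · rw [endValue_conj, endValue_conj, h3.continuous v d hd d' hd']
  · simp only [hout, ← map_sum, h3.sum_zero v, map_zero]

/-- As the eigenvalue is simple, the complex conjugate of a generic eigenfunction is a multiple of
it. So it is a complex multiple of a real function, and on each edge it is a shifted cosine. -/
theorem IsGeneric.exists_eq_cos [Fintype V] [Fintype E] {G : MetricGraph V E} {k : ℝ}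
    (hk : 0 < k) {f : E → ℝ → ℂ} (hf : G.IsGeneric (k ^ 2) f) (e : E) :
    ∃ s ∈ Set.Ioc 0 Real.pi, ∃ A : ℂ, A ≠ 0 ∧ ∀ x ∈ Set.Icc 0 (G.len e),
      f e x = A * (Real.cos (k * x - s) : ℂ) := by
  have h0 : (0 : ℝ) ∈ Set.Icc 0 (G.len e) := ⟨le_rfl, (G.len_pos e).le⟩
  obtain ⟨-, h2, -⟩ := (G.solvesEigen_sq_iff hk f).1 hf.mem
  obtain ⟨a, b, hab⟩ := h2 e
  have ha : a ≠ 0 := by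
    rw [← (G.endValue_outDeriv_of_eqOn_trig hab).1]
    exact hf.value_ne_zero _ _ (G.mem_edgesAt.2 rfl)
  have hne : (⟨f, hf.mem⟩ : G.eigenspace (k ^ 2)) ≠ 0 := fun h =>
    hf.ne_zero (congrArg Subtype.val h)
  obtain ⟨r, hr⟩ := exists_smul_eq_of_finrank_eq_one hf.simple hne
    ⟨fun e x => (starRingEnd ℂ) (f e x), SolvesEigen.conj hk hf.mem⟩
  have hr' : ∀ x, (starRingEnd ℂ) (f e x) = r * f e x := fun x =>
    (congrFun (congrFun (congrArg Subtype.val hr) e) x).symm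
  have hra : (starRingEnd ℂ) a = r * a := by
    simpa [hab 0 h0] using hr' 0
  have hrb : (starRingEnd ℂ) b = r * b := by
    have hab' : ∀ x ∈ Set.Icc 0 (G.len e), (r • f) e x
        = (starRingEnd ℂ) a * (Real.cos (k * x) : ℂ)
          + (starRingEnd ℂ) b * (Real.sin (k * x) : ℂ) := by
      intro x hx
      change r * f e x = _
      rw [← hr', hab x hx, map_add, map_mul, map_mul, Complex.conj_ofReal, Complex.conj_ofReal]
    have h3 := (G.endValue_outDeriv_of_eqOn_trig hab').2.2.1
    rw [outDeriv_smul, (G.endValue_outDeriv_of_eqOn_trig hab).2.2.1, mul_left_comm] at h3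
    exact (mul_left_cancel₀ (by exact_mod_cast hk.ne') h3).symm
  have hr0 : r ≠ 0 := by
    rintro rfl
    rw [zero_mul] at hra
    exact ha ((map_eq_zero _).1 hra)
  obtain ⟨q, hq⟩ := Complex.conj_eq_iff_real.1 (show (starRingEnd ℂ) (b / a) = b / a by
    rw [map_div₀, hra, hrb, mul_div_mul_left _ _ hr0])
  obtain ⟨s, hs, A, hA, hphase⟩ := Real.exists_phase q
  -- The coefficients of `f` on the edge have the real ratio `q = b / a`.
  refine ⟨s, hs, a * A, mul_ne_zero ha (by exact_mod_cast hA), fun x hx => ?_⟩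
  rw [hab x hx, mul_assoc, ← Complex.ofReal_mul, ← hphase (k * x), ← div_mul_cancel₀ b ha, hq]
  push_cast
  ring

/-- The shape of an eigenfunction on a graph with edges longer than half a wavelength. In the
coordinate `k * x`, the distance from the edge end `d` to the nearest Neumann point is `s d`, the
edge `e` has `n e + 1` Neumann points, and `A d` is the value at that nearest Neumann point. -/
structure WaveData (G : MetricGraph V E) (k : ℝ) (f : E → ℝ → ℂ) (s : E × Bool → ℝ) (n : E → ℕ)
    (A : E × Bool → ℂ) : Prop where
  mem_Ioc : ∀ d, s d ∈ Set.Ioc 0 Real.pi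
  len_eq : ∀ e, k * G.len e = s (e, false) + n e * Real.pi + s (e, true)
  amplitude_ne_zero : ∀ d, A d ≠ 0
  endValue_eq : ∀ d, G.endValue f d = A d * (Real.cos (s d) : ℂ)
  outDeriv_eq : ∀ d, G.outDeriv f d = k * (A d * (Real.sin (s d) : ℂ))
  mem_neumannSet : ∀ e x, (e, x) ∈ G.neumannSet f ↔
    ∃ j : ℕ, j ≤ n e ∧ x = (s (e, false) + j * Real.pi) / k
  nodal_finite : ∀ e, {x | (e, x) ∈ G.nodalSet f}.Finite
  nodal_ncard : ∀ e, {x | (e, x) ∈ G.nodalSet f}.ncard = n e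
    + (if Real.pi / 2 < s (e, false) then 1 else 0) + (if Real.pi / 2 < s (e, true) then 1 else 0)

theorem IsGeneric.exists_waveData [Fintype V] [Fintype E] {G : MetricGraph V E} {k : ℝ}
    (hk : 0 < k) (hlen : ∀ e, Real.pi < k * G.len e) {f : E → ℝ → ℂ}
    (hf : G.IsGeneric (k ^ 2) f) : ∃ s n A, G.WaveData k f s n A := by
  have hk' : (k : ℂ) ≠ 0 := by exact_mod_cast hk.ne'
  choose s hs A hA hfA using fun e => hf.exists_eq_cos hk e
  choose n t ht hl using fun e => Real.exists_eq_add_nat_mul_pi_add ((hs e).2.trans_lt (hlen e))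
  have htrig : ∀ e, ∀ x ∈ Set.Icc 0 (G.len e),
      f e x = (A e * (Real.cos (s e) : ℂ)) * (Real.cos (k * x) : ℂ)
        + (A e * (Real.sin (s e) : ℂ)) * (Real.sin (k * x) : ℂ) := by
    intro e x hx
    rw [hfA e x hx, Real.cos_sub]
    push_cast
    ring
  have hends := fun e => G.endValue_outDeriv_of_eqOn_trig (htrig e)
  have hdiff : ∀ e, k * G.len e - s e = t e + n e * Real.pi := fun e => by rw [hl e]; ring
  refine ⟨fun d => if d.2 then t d.1 else s d.1, n,
    fun d => if d.2 then A d.1 * (-1) ^ n d.1 else A d.1, ?_, hl, ?_, ?_, ?_, ?_, ?_, ?_⟩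
  · rintro ⟨e, _ | _⟩
    · exact hs e
    · exact ht e
  · rintro ⟨e, _ | _⟩
    · exact hA e
    · exact mul_ne_zero (hA e) (pow_ne_zero _ (by norm_num))
  · rintro ⟨e, _ | _⟩
    · exact (hends e).1
    · have h := hfA e (G.len e) ⟨(G.len_pos e).le, le_rfl⟩
      rw [hdiff, Real.cos_add_nat_mul_pi] at h
      refine h.trans ?_
      simp only [if_true]
      push_cast
      ring
  · rintro ⟨e, _ | _⟩
    · exact (hends e).2.2.1
    · have h : Real.sin (k * G.len e) * Real.cos (s e) - Real.cos (k * G.len e) * Real.sin (s e)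
          = (-1) ^ n e * Real.sin (t e) := by
        rw [← Real.sin_sub, hdiff, Real.sin_add_nat_mul_pi]
      have h' := congrArg (fun y : ℝ => (y : ℂ)) h
      simp only [Complex.ofReal_sub, Complex.ofReal_mul, Complex.ofReal_pow, Complex.ofReal_neg,
        Complex.ofReal_one] at h'
      rw [(hends e).2.2.2]
      simp only [if_true]
      linear_combination (k : ℂ) * A e * h'
  · intro e x
    refine Iff.trans ?_ (sin_wave_eq_zero_iff hk (hs e) (ht e) (hl e) x)
    refine and_congr_right fun hx => ?_
    have hd : G.edgeDeriv f e x = -(k * A e) * (Real.sin (k * x - s e) : ℂ) := by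
      refine (derivWithin_eq_of_eqOn_trig (G.len_pos e) (htrig e) (Set.Ioo_subset_Icc_self hx)).2.trans
        ?_
      rw [Real.sin_sub]
      push_cast
      ring
    change G.edgeDeriv f e x = 0 ↔ _
    rw [hd, mul_eq_zero, or_iff_right (neg_ne_zero.2 (mul_ne_zero hk' (hA e))),
      Complex.ofReal_eq_zero]
  all_goals
    intro e
    have hset : {x | (e, x) ∈ G.nodalSet f}
        = {x | x ∈ Set.Ioo 0 (G.len e) ∧ Real.cos (k * x - s e) = 0} := by
      ext x
      refine and_congr_right fun hx => ?_
      change f e x = 0 ↔ _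
      rw [hfA e x (Set.Ioo_subset_Icc_self hx), mul_eq_zero, or_iff_right (hA e),
        Complex.ofReal_eq_zero]
    rw [hset]
  · exact (cos_wave_zeros hk (hs e) (ht e) (hl e)).1
  · exact (cos_wave_zeros hk (hs e) (ht e) (hl e)).2

end MetricGraph

/-! ### Summation over the edge ends -/

theorem Set.finite_and_ncard_eq_sum_fibers {α β : Type*} [Fintype α] (S : Set (α × β))
    (h : ∀ a, {b | (a, b) ∈ S}.Finite) :
    S.Finite ∧ S.ncard = ∑ a, {b | (a, b) ∈ S}.ncard := by
  classical
  have hS : S = (Finset.univ.biUnion fun a => (h a).toFinset.image (Prod.mk a) :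
      Finset (α × β)) := by
    ext ⟨a, b⟩
    simp
  have hdisj : ((Finset.univ : Finset α) : Set α).PairwiseDisjoint
      fun a => (h a).toFinset.image (Prod.mk a) := by
    intro a _ a' _ hne
    refine Finset.disjoint_left.2 fun p hp hp' => hne ?_
    obtain ⟨b, -, rfl⟩ := Finset.mem_image.1 hp
    obtain ⟨b', -, hb'⟩ := Finset.mem_image.1 hp'
    exact (congrArg Prod.fst hb').symm
  refine ⟨hS ▸ Finset.finite_toSet _, ?_⟩
  conv_lhs => rw [hS, Set.ncard_coe_finset]
  rw [Finset.card_biUnion hdisj]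
  refine Finset.sum_congr rfl fun a _ => ?_
  rw [Finset.card_image_of_injective _ (Prod.mk_right_injective a),
    Set.ncard_eq_toFinset_card _ (h a)]

theorem MetricGraph.WaveData.mul_stubLength {V E : Type*} {G : MetricGraph V E} {k : ℝ}
    {f : E → ℝ → ℂ} {s : E × Bool → ℝ} {n : E → ℕ} {A : E × Bool → ℂ}
    (D : G.WaveData k f s n A) (hk : 0 < k) (d : E × Bool) :
    k * G.stubLength (fun e => s (e, false) / k)
      (fun e => (s (e, false) + n e * Real.pi) / k) d = s d := by
  obtain ⟨e, _ | _⟩ := d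
  · exact mul_div_cancel₀ _ hk.ne'
  · rw [MetricGraph.stubLength, mul_sub, mul_div_cancel₀ _ hk.ne', D.len_eq]
    ring

namespace MetricGraph

variable {V E : Type*} [Fintype E] {G : MetricGraph V E}

theorem sum_interior_add_sum_boundary [Fintype V] {R : Type*} [AddCommMonoid R]
    (g : E × Bool → R) :
    ∑ v ∈ G.interior, ∑ d ∈ G.edgesAt v, g d + ∑ v ∈ G.boundary, ∑ d ∈ G.edgesAt v, g d
      = ∑ e, (g (e, false) + g (e, true)) := by
  classical
  have h1 : ∑ v, ∑ d ∈ G.edgesAt v, g d = ∑ d, g d := by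
    rw [← Finset.sum_fiberwise Finset.univ (fun d : E × Bool => G.ends d.1 d.2) g]
    refine Finset.sum_congr rfl fun v _ => Finset.sum_congr ?_ fun _ _ => rfl
    unfold edgesAt
    congr
  have h2 : ∑ d, g d = ∑ e, (g (e, false) + g (e, true)) := by
    rw [Fintype.sum_prod_type]
    refine Finset.sum_congr rfl fun e _ => ?_
    rw [Fintype.sum_bool, add_comm]
  rw [← h2, ← h1, add_comm]
  have := Finset.sum_filter_add_sum_filter_not Finset.univ (fun v => G.deg v = 1)
    (fun v => ∑ d ∈ G.edgesAt v, g d)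
  rw [← this]
  unfold interior boundary
  congr

namespace WaveData

variable {k : ℝ} {f : E → ℝ → ℂ} {s : E × Bool → ℝ} {n : E → ℕ} {A : E × Bool → ℂ}

theorem nodalSet_finite_and_count (D : G.WaveData k f s n A) : (G.nodalSet f).Finite ∧
    G.nodalCount f = ∑ e, (n e + (if Real.pi / 2 < s (e, false) then 1 else 0)
      + (if Real.pi / 2 < s (e, true) then 1 else 0)) := by
  obtain ⟨h1, h2⟩ := Set.finite_and_ncard_eq_sum_fibers (G.nodalSet f) D.nodal_finite
  exact ⟨h1, h2.trans (Finset.sum_congr rfl fun e _ => D.nodal_ncard e)⟩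

theorem neumannSet_finite_and_count (D : G.WaveData k f s n A) (hk : 0 < k) :
    (G.neumannSet f).Finite ∧ G.neumannCount f = ∑ e, (n e + 1) := by
  have hfib : ∀ e, {x | (e, x) ∈ G.neumannSet f}
      = (fun j : ℕ => (s (e, false) + j * Real.pi) / k) '' (Finset.range (n e + 1) : Set ℕ) := by
    intro e
    ext x
    refine (D.mem_neumannSet e x).trans ?_
    simp only [Set.mem_image, Finset.coe_range, Set.mem_Iio, Nat.lt_succ_iff]
    exact exists_congr fun j => and_congr_right fun _ => eq_comm
  have hinj : ∀ e, Function.Injective (fun j : ℕ => (s (e, false) + j * Real.pi) / k) := by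
    intro e i j h
    have := mul_right_cancel₀ Real.pi_pos.ne' (add_left_cancel ((div_left_inj' hk.ne').1 h))
    exact_mod_cast this
  obtain ⟨h1, h2⟩ := Set.finite_and_ncard_eq_sum_fibers (G.neumannSet f)
    (fun e => hfib e ▸ (Finset.finite_toSet _).image _)
  refine ⟨h1, h2.trans (Finset.sum_congr rfl fun e _ => ?_)⟩
  rw [hfib, (hinj e).injOn.ncard_image, Set.ncard_coe_finset, Finset.card_range]

theorem cutEnds (D : G.WaveData k f s n A) (hk : 0 < k) :
    CutEnds (G.neumannPoints f) (fun e => s (e, false) / k)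
      (fun e => (s (e, false) + n e * Real.pi) / k) := by
  have hmem : ∀ e x, (e, x) ∈ G.neumannPoints f ↔
      ∃ j : ℕ, j ≤ n e ∧ x = (s (e, false) + j * Real.pi) / k := by
    intro e x
    rw [← D.mem_neumannSet, neumannPoints, dif_pos (D.neumannSet_finite_and_count hk).1,
      Set.Finite.mem_toFinset]
  refine ⟨fun e => (hmem e _).2 ⟨0, Nat.zero_le _, by simp⟩, fun e x hx => ?_,
    fun e => (hmem e _).2 ⟨n e, le_rfl, rfl⟩, fun e x hx => ?_⟩
  · obtain ⟨j, -, rfl⟩ := (hmem e x).1 hx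
    have : 0 ≤ (j : ℝ) * Real.pi := mul_nonneg j.cast_nonneg Real.pi_pos.le
    exact div_le_div_of_nonneg_right (by linarith) hk.le
  · obtain ⟨j, hj, rfl⟩ := (hmem e x).1 hx
    have : (j : ℝ) * Real.pi ≤ n e * Real.pi :=
      mul_le_mul_of_nonneg_right (by exact_mod_cast hj) Real.pi_pos.le
    exact div_le_div_of_nonneg_right (by linarith) hk.le

theorem exists_equiv_edgesAt (D : G.WaveData k f s n A) (hk : 0 < k) (v : V) :
    ∃ φ : {d // d ∈ G.edgesAt v} ≃ G.NeumannDomainE f v,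
      ∀ d, k * (G.neumannDomain f v).len (φ d) = s d := by
  obtain ⟨φ, hφ⟩ := (D.cutEnds hk).exists_equiv_edgesAt (G.neumannPoints_mem f) v
  exact ⟨φ, fun d => (congrArg (k * ·) (hφ d)).trans (D.mul_stubLength hk d.1)⟩

theorem sum_neumannDomain (D : G.WaveData k f s n A) (hk : 0 < k) (v : V) {R : Type*}
    [AddCommMonoid R] (g : ℝ → R) :
    ∑ e', g (k * (G.neumannDomain f v).len e') = ∑ d ∈ G.edgesAt v, g (s d) := by
  obtain ⟨φ, hφ⟩ := D.exists_equiv_edgesAt hk v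
  rw [← Finset.sum_coe_sort (G.edgesAt v)]
  exact (Fintype.sum_equiv φ _ _ fun d => by rw [hφ d]).symm

theorem wavelengthCapacity_neumannDomain (D : G.WaveData k f s n A) (hk : 0 < k) (v : V) :
    (G.neumannDomain f v).wavelengthCapacity k = ∑ d ∈ G.edgesAt v, s d / Real.pi := by
  rw [← D.sum_neumannDomain hk v (fun x => x / Real.pi), ← Finset.sum_div, ← Finset.mul_sum]
  change (∑ e', (G.neumannDomain f v).len e') / Real.pi * k = _
  ring

/-- At the end of an edge where the derivative does not vanish, the tangent of `s d` is, up to the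
factor `k`, the logarithmic derivative of the eigenfunction; so the Kirchhoff condition makes the
wave number `k` a zero of the secular function of the Neumann domain. -/
theorem spectralCount_neumannDomain [Fintype V] (D : G.WaveData k f s n A) (hk : 0 < k)
    (hf : G.IsGeneric (k ^ 2) f) {v : V} (hv : v ∈ G.interior) :
    (G.neumannDomain f v).SpectralCountFinite k ∧ (G.neumannDomain f v).spectralCount k
      = ∑ d ∈ G.edgesAt v, if Real.pi / 2 < s d then 1 else 0 := by
  have hcos : ∀ d ∈ G.edgesAt v, Real.cos (s d) ≠ 0 := by
    intro d hd h
    apply hf.value_ne_zero v d hd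
    rw [D.endValue_eq, h, Complex.ofReal_zero, mul_zero]
  have hlt : ∀ d ∈ G.edgesAt v, s d < Real.pi := by
    intro d hd
    refine (D.mem_Ioc d).2.lt_of_ne fun h => hf.deriv_ne_zero v hv d hd ?_
    rw [D.outDeriv_eq, h, Real.sin_pi, Complex.ofReal_zero, mul_zero, mul_zero]
  have htan : ∑ d ∈ G.edgesAt v, Real.tan (s d) = 0 := by
    rcases (G.edgesAt v).eq_empty_or_nonempty with hE | ⟨d₀, hd₀⟩
    · rw [hE, Finset.sum_empty]
    have hN := (show G.SolvesEigen (k ^ 2) f from hf.mem).neumann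
    have hsum := hN.sum_zero v
    have hterm : ∀ d ∈ G.edgesAt v, G.outDeriv f d
        = k * G.endValue f d₀ * (Real.tan (s d) : ℂ) := by
      intro d hd
      have hc : (Real.cos (s d) : ℂ) ≠ 0 := by exact_mod_cast hcos d hd
      rw [hN.continuous v d₀ hd₀ d hd, D.endValue_eq, D.outDeriv_eq, Real.tan_eq_sin_div_cos,
        Complex.ofReal_div]
      field_simp
    rw [Finset.sum_congr rfl hterm, ← Finset.mul_sum] at hsum
    have hk' : (k : ℂ) ≠ 0 := by exact_mod_cast hk.ne'
    have := (mul_eq_zero.1 hsum).resolve_left (mul_ne_zero hk' (hf.value_ne_zero v d₀ hd₀))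
    exact_mod_cast this
  obtain ⟨φ, hφ⟩ := D.exists_equiv_edgesAt hk v
  have hφ' : ∀ e', ∃ d ∈ G.edgesAt v, k * (G.neumannDomain f v).len e' = s d := fun e' =>
    ⟨(φ.symm e').1, (φ.symm e').2, by rw [← hφ, φ.apply_symm_apply]⟩
  -- The centre of the star is the start of a piece of the form `Sum.inl e`, and the end of a piece
  -- that starts at a Neumann point.
  have hstar : (G.neumannDomain f v).IsStar ⟨Sum.inl v, SimpleGraph.Reachable.refl _⟩
      (fun e' => e'.1.isRight) :=
    (D.cutEnds hk).component_isStar (G.neumannPoints_mem f) v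
  have hmain := hstar.spectralCount_eq hk
    (fun e' => by obtain ⟨d, hd, h⟩ := hφ' e'; exact h ▸ hlt d hd)
    (fun e' => by obtain ⟨d, hd, h⟩ := hφ' e'; exact h ▸ hcos d hd)
    (by rw [D.sum_neumannDomain hk v Real.tan, htan])
  refine ⟨hmain.1, hmain.2.trans ?_⟩
  rw [Finset.card_filter]
  exact D.sum_neumannDomain hk v (fun x => if Real.pi / 2 < x then 1 else 0)

/-- The edge end at a boundary vertex is half a wavelength away from the nearest Neumann point. -/
theorem sum_edgesAt_boundary [Fintype V] (D : G.WaveData k f s n A) (hk : 0 < k)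
    (hf : G.SolvesEigen (k ^ 2) f) {v : V} (hv : v ∈ G.boundary) {R : Type*} [AddCommMonoid R]
    (g : ℝ → R) : ∑ d ∈ G.edgesAt v, g (s d) = g Real.pi := by
  have hdeg : G.deg v = 1 := by simpa [boundary] using hv
  obtain ⟨d, hd⟩ := Finset.card_eq_one.1 hdeg
  have h0 := hf.neumann.sum_zero v
  rw [hd, Finset.sum_singleton, D.outDeriv_eq] at h0
  have hk' : (k : ℂ) ≠ 0 := by exact_mod_cast hk.ne'
  have hsin : Real.sin (s d) = 0 := by
    exact_mod_cast (mul_eq_zero.1 ((mul_eq_zero.1 h0).resolve_left hk')).resolve_left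
      (D.amplitude_ne_zero d)
  have hs : s d = Real.pi := by
    refine (D.mem_Ioc d).2.eq_of_not_lt fun h => ?_
    exact (Real.sin_pos_of_pos_of_lt_pi (D.mem_Ioc d).1 h).ne' hsin
  rw [hd, Finset.sum_singleton, hs]

end WaveData

end MetricGraph

theorem mainTheorem11 {V E : Type*} [Fintype V] [Fintype E] (G : MetricGraph V E)
    (hG : G.IsStandard) (k : ℝ) (f : E → ℝ → ℂ) (hf : G.IsGeneric (k ^ 2) f)
    (hk : Real.pi / G.minLength < k) :
    -- all the quantities below are finite
    (G.nodalSet f).Finite ∧ (G.neumannSet f).Finite ∧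
    (∀ v ∈ G.interior, (G.neumannDomain f v).SpectralCountFinite k) ∧
    -- the sum of the spectral positions
    (∑ v ∈ G.interior, ((G.neumannDomain f v).spectralCount k : ℤ)
      = (G.nodalCount f : ℤ) - G.neumannCount f + Fintype.card E - G.boundary.card) ∧
    -- the sum of the wavelength capacities
    (∑ v ∈ G.interior, (G.neumannDomain f v).wavelengthCapacity k
      = G.totalLength / Real.pi * k - G.neumannCount f + Fintype.card E - G.boundary.card) := by
  have hpi := Real.pi_pos
  have hE : Nonempty E := Fintype.card_pos_iff.1 (zero_lt_one.trans hG.one_lt_card)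
  obtain ⟨e₀, he₀⟩ := exists_eq_ciInf_of_finite (f := G.len)
  have hmin : 0 < G.minLength := by
    rw [MetricGraph.minLength, ← he₀]
    exact G.len_pos e₀
  have hk0 : 0 < k := (div_pos hpi hmin).trans hk
  have hlen : ∀ e, Real.pi < k * G.len e := fun e =>
    ((div_lt_iff₀ hmin).1 hk).trans_le
      (mul_le_mul_of_nonneg_left (ciInf_le (Set.finite_range G.len).bddBelow e) hk0.le)
  obtain ⟨s, n, A, D⟩ := hf.exists_waveData hk0 hlen
  obtain ⟨hnod, hnodc⟩ := D.nodalSet_finite_and_count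
  obtain ⟨hneu, hneuc⟩ := D.neumannSet_finite_and_count hk0
  have hspec := fun v hv => D.spectralCount_neumannDomain hk0 hf (v := v) hv
  refine ⟨hnod, hneu, fun v hv => (hspec v hv).1, ?_, ?_⟩
  · have hsum := G.sum_interior_add_sum_boundary (fun d => if Real.pi / 2 < s d then 1 else 0)
    rw [← Finset.sum_congr rfl fun v hv => (hspec v hv).2,
      Finset.sum_congr rfl fun v hv => D.sum_edgesAt_boundary hk0 hf.mem hv
        (fun x => if Real.pi / 2 < x then 1 else 0)] at hsum
    simp only [half_lt_self hpi, if_true, Finset.sum_const, smul_eq_mul, mul_one] at hsum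
    simp only [add_assoc, Finset.sum_add_distrib, Finset.sum_const, Finset.card_univ, smul_eq_mul,
      mul_one] at hsum hnodc hneuc
    rw [← Nat.cast_sum]
    omega
  · have hsum := G.sum_interior_add_sum_boundary (fun d => s d / Real.pi)
    rw [← Finset.sum_congr rfl fun v _ => D.wavelengthCapacity_neumannDomain hk0 v,
      Finset.sum_congr rfl fun v hv => D.sum_edgesAt_boundary hk0 hf.mem hv
        (fun x => x / Real.pi)] at hsum
    simp only [div_self hpi.ne', Finset.sum_const, nsmul_eq_mul, mul_one] at hsum
    have hL : G.totalLength / Real.pi * k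
        = ∑ e, (s (e, false) / Real.pi + s (e, true) / Real.pi) + ∑ e, (n e : ℝ) := by
      rw [MetricGraph.totalLength, Finset.sum_div, Finset.sum_mul, ← Finset.sum_add_distrib]
      refine Finset.sum_congr rfl fun e _ => ?_
      have := D.len_eq e
      field_simp
      linarith
    rw [hneuc, hL, ← hsum]
    push_cast
    simp only [Finset.sum_add_distrib, Finset.sum_const, Finset.card_univ, nsmul_eq_mul, mul_one]
    ring
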